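/- Let $d\ge 1$ be an integer, let $R$ and $S$ be Cohen–Macaulay (Noetherian) local rings with $\dim R=\dim S=d$, and let $T$ be a regular local ring with $\dim T=d-1$. Let $f\colon R\to T$ and $g\colon S\to T$ be surjective ring homomorphisms, and let $$A=R\times_T S=\{(a,b)\in R\times S \mid f(a)=g(b)\}$$ be their fiber product, a subring of $R\times S$. Then $A$ is a Gorenstein local ring (that is, a Noetherian local ring of finite injective dimension over itself) if and only if both $R$ and $S$ are regular local rings. -/

import Mathlib

/-- The fiber product `R ×_T S = {(a, b) ∈ R × S | f a = g b}` of ring homomorphisms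
`f : R → T` and `g : S → T`, as a subring of `R × S`. -/
def fiberProduct {R S T : Type*} [CommRing R] [CommRing S] [CommRing T]
    (f : R →+* T) (g : S →+* T) : Subring (R × S) :=
  RingHom.eqLocus (f.comp (RingHom.fst R S)) (g.comp (RingHom.snd R S))

theorem mem_fiberProduct {R S T : Type*} [CommRing R] [CommRing S] [CommRing T]
    {f : R →+* T} {g : S →+* T} {x : R × S} :
    x ∈ fiberProduct f g ↔ f x.1 = g x.2 :=
  Iff.rfl

/-- The depth of a local ring: the supremum of the lengths of the regular sequences
on `R` consisting of elements of the maximal ideal. -/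
noncomputable def localDepth (R : Type*) [CommRing R] [IsLocalRing R] : ℕ∞ :=
  ⨆ (rs : List R) (_ : (∀ r ∈ rs, r ∈ IsLocalRing.maximalIdeal R) ∧
    RingTheory.Sequence.IsRegular R rs), (rs.length : ℕ∞)

/-- A Cohen-Macaulay local ring: a Noetherian local ring whose depth is its Krull dimension. -/
class IsCohenMacaulayLocalRing (R : Type*) [CommRing R] : Prop extends
    IsLocalRing R, IsNoetherianRing R where
  depth_eq_dim : (localDepth R : WithBot ℕ∞) = ringKrullDim R

/-- A Gorenstein local ring: a Noetherian local ring which has finite injective dimension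
as a module over itself. -/
class IsGorensteinLocalRing (A : Type*) [CommRing A] : Prop extends
    IsLocalRing A, IsNoetherianRing A where
  finite_injectiveDimension :
    ∃ n : ℕ, CategoryTheory.HasInjectiveDimensionLE (ModuleCat.of A A) n

/-!
Write `A = R ×_T S`. Generators of the maximal ideal of `T` lift to sequences `rs` in `R` and `ss` in
`S`, which combine to a sequence `us` in `A`; with `x ∈ ker f` and `y ∈ ker g` one adds `z = (x, y)`.
If `rs, x` and `ss, y` are regular, so is `us, z`, because `T` contributes only the regular sequence
of generators of its maximal ideal (`isWeaklyRegular_append_of_fiberProduct`). The question becomes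
one about the Artinian ring `A / q`, `q = (us, z)`, in which the class of `w = (x, 0)` is killed by
the maximal ideal.

If `R` and `S` are regular, then `ker f = (x)` and `ker g = (y)`
(`IsRegularLocalRing.exists_ker_eq_span_singleton`), so the maximal ideal of `A` is `q + (w)` and
`A / q` has length two. That `A` has finite injective dimension is proved directly in
`hasInjectiveDimensionLE_of_length_two`.

Conversely, if `A` is Gorenstein, then `A / q` is self-injective, in the form of the colon property
`mem_sup_span_of_hasInjectiveDimensionLE`: if every multiplier taking `v` into `q` also takes `w`
into `q`, then `w ∈ q + (v)`. For `ν ∈ ker f` and `v = (ν, 0)` outside `q` this writes `w` modulo `q`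
as a multiple of `v`. As soon as `x` is a minimal generator of the maximal ideal of `R` modulo `rs`,
the multiplier is a unit, and `ν ∈ (rs, x)`: the maximal ideal of `R` is generated by the
`dim R` elements `rs, x` (`RingHom.IsFiberProduct.maximalIdeal_eq_ofList`). The required `rs, x` are
found inside the Cohen-Macaulay ring `R` by prime avoidance along cosets of `ker f`
(`exists_isWeaklyRegular_append_singleton`).
-/

/-! ### Regular local rings -/

/-- Prime avoidance for a coset `a + I`: maximal members of `s` suffice, and the summand `c` is
taken to vanish modulo exactly those maximal members that do not contain `a`. -/
theorem Ideal.exists_mem_forall_add_notMem {R : Type*} [CommRing R] {s : Set (Ideal R)}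
    (hs : s.Finite) (hp : ∀ Q ∈ s, Q.IsPrime) (a : R) (I : Ideal R) (hI : ∀ Q ∈ s, ¬ I ≤ Q) :
    ∃ c ∈ I, ∀ Q ∈ s, a + c ∉ Q := by
  classical
  have hs' : {Q | Maximal (· ∈ s) Q}.Finite := hs.subset fun Q hQ ↦ hQ.prop
  let t : Finset (Ideal R) := {Q ∈ hs'.toFinset | a ∉ Q}
  let u : Set (Ideal R) := {Q | Maximal (· ∈ s) Q ∧ a ∈ Q}
  have hu : u.Finite := hs'.subset fun Q hQ ↦ hQ.1
  have key : ¬ ((I ⊓ t.inf id : Ideal R) : Set R) ⊆ ⋃ Q ∈ u, ((id Q : Ideal R) : Set R) := by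
    refine fun hsub ↦ absurd ((Ideal.subset_union_prime_finite hu (f := id) ⊥ ⊥
      fun Q hQ _ _ ↦ hp Q hQ.1.prop).1 hsub) ?_
    rintro ⟨Q, ⟨hQ, haQ⟩, hle⟩
    have := hp Q hQ.prop
    rcases (Ideal.IsPrime.inf_le this).1 hle with h | h
    · exact hI Q hQ.prop h
    · obtain ⟨Q', hQ', h⟩ := (Ideal.IsPrime.inf_le' this).1 h
      simp only [t, Finset.mem_filter, Set.Finite.mem_toFinset] at hQ'
      exact hQ'.2 (hQ'.1.eq_of_le hQ.prop h ▸ haQ)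
  obtain ⟨c, hc, hcu⟩ := Set.not_subset.1 key
  refine ⟨c, hc.1, fun Q hQ hac ↦ ?_⟩
  obtain ⟨Q', hle, hQ'⟩ := hs.exists_le_maximal hQ
  have hac' := hle hac
  by_cases ha : a ∈ Q'
  · exact hcu (Set.mem_biUnion (show Q' ∈ u from ⟨hQ', ha⟩) ((Q'.add_mem_iff_right ha).1 hac'))
  · have : t.inf id ≤ Q' := Finset.inf_le (f := id) (by simp [t, hQ', ha])
    exact ha ((Q'.add_mem_iff_left (this hc.2)).1 hac')

open IsLocalRing Ideal RingTheory.Sequence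

theorem Ideal.spanFinrank_ofList_le {R : Type*} [CommRing R] (l : List R) :
    (ofList l).spanFinrank ≤ l.length := by
  classical
  have h : ofList l = Submodule.span R (l.toFinset : Set R) := by
    simp [ofList]
  rw [h]
  refine (Submodule.spanFinrank_span_le_ncard_of_finite (Finset.finite_toSet _)).trans ?_
  rw [Set.ncard_coe_finset]
  exact l.toFinset_card_le

theorem IsRegularLocalRing.exists_ofList_eq_maximalIdeal (R : Type*) [CommRing R]
    [IsRegularLocalRing R] :
    ∃ l : List R, ofList l = maximalIdeal R ∧ (l.length : WithBot ℕ∞) = ringKrullDim R := by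
  have fg := (maximalIdeal R).fg_of_isNoetherianRing
  have fin := Submodule.FG.finite_generators fg
  refine ⟨fin.toFinset.toList, ?_, ?_⟩
  · rw [ofList]; simp only [Finset.mem_toList, Set.Finite.mem_toFinset, Set.ofPred_mem_eq]
    exact (maximalIdeal R).span_generators
  · rw [← IsRegularLocalRing.spanFinrank_maximalIdeal, Finset.length_toList,
      ← Submodule.FG.generators_ncard fg, Set.ncard_eq_toFinset_card _ fin]

theorem ringKrullDim_le_length_of_maximalIdeal_le {R : Type*} [CommRing R] [IsLocalRing R]
    [IsNoetherianRing R] {l : List R} (h : maximalIdeal R = ofList l) :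
    ringKrullDim R ≤ l.length := by
  refine (ringKrullDim_le_spanFinrank_maximalIdeal (R := R)).trans ?_
  rw [h]; exact_mod_cast spanFinrank_ofList_le l

theorem IsRegularLocalRing.of_maximalIdeal_eq_ofList {R : Type*} [CommRing R] [IsLocalRing R]
    [IsNoetherianRing R] {l : List R} (h : maximalIdeal R = ofList l)
    (hl : (l.length : WithBot ℕ∞) ≤ ringKrullDim R) : IsRegularLocalRing R := by
  refine .of_spanFinrank_maximalIdeal_le R (le_trans ?_ hl)
  rw [h]; exact_mod_cast spanFinrank_ofList_le l

theorem IsLocalRing.maximalIdeal_quotient {R : Type*} [CommRing R] [IsLocalRing R] (I : Ideal R)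
    [IsLocalRing (R ⧸ I)] : maximalIdeal (R ⧸ I) = (maximalIdeal R).map (Ideal.Quotient.mk I) :=
  (map_maximalIdeal_of_surjective _ Ideal.Quotient.mk_surjective).symm

theorem ringKrullDim_quotient_le_of_maximalIdeal_le {R : Type*} [CommRing R] [IsLocalRing R]
    [IsNoetherianRing R] {I : Ideal R} (hI : I ≠ ⊤) {l : List R}
    (h : maximalIdeal R = I ⊔ ofList l) : ringKrullDim (R ⧸ I) ≤ l.length := by
  have : Nontrivial (R ⧸ I) := Ideal.Quotient.nontrivial_iff.2 hI
  have := IsLocalRing.of_surjective' _ (Ideal.Quotient.mk_surjective (I := I))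
  refine (ringKrullDim_le_length_of_maximalIdeal_le
    (l := l.map (Ideal.Quotient.mk I)) ?_).trans (by simp)
  rw [maximalIdeal_quotient, h, Ideal.map_sup, Ideal.map_quotient_self, bot_sup_eq, map_ofList]

/-- Dividing a regular local ring by part of a regular system of parameters leaves a regular local
ring, of the expected dimension. -/
theorem IsRegularLocalRing.quotient_ofList {R : Type*} [CommRing R] [IsLocalRing R]
    [IsNoetherianRing R] {l₁ l₂ : List R} (h : maximalIdeal R = ofList (l₁ ++ l₂))
    (hl : ((l₁ ++ l₂).length : WithBot ℕ∞) = ringKrullDim R) :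
    IsRegularLocalRing (R ⧸ ofList l₁) ∧
      ringKrullDim (R ⧸ ofList l₁) = (l₂.length : WithBot ℕ∞) := by
  rw [ofList_append] at h
  have hle : ofList l₁ ≤ maximalIdeal R := h ▸ le_sup_left
  have htop : ofList l₁ ≠ ⊤ := ne_top_of_le_ne_top Ideal.IsPrime.ne_top' hle
  have : Nontrivial (R ⧸ ofList l₁) := Ideal.Quotient.nontrivial_iff.2 htop
  have := IsLocalRing.of_surjective' _ (Ideal.Quotient.mk_surjective (I := ofList l₁))
  have hdim := ringKrullDim_quotient_le_of_maximalIdeal_le htop h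
  have hdim' : (l₂.length : WithBot ℕ∞) ≤ ringKrullDim (R ⧸ ofList l₁) := by
    have h1 := ringKrullDim_le_ringKrullDim_quotient_add_spanFinrank (ofList l₁)
      (by rwa [ringJacobson_eq_maximalIdeal])
    have h2 : ringKrullDim R ≤ ringKrullDim (R ⧸ ofList l₁) + (l₁.length : ℕ) :=
      h1.trans (by gcongr; exact_mod_cast spanFinrank_ofList_le l₁)
    rw [← hl, List.length_append, Nat.cast_add, add_comm] at h2
    exact ENat.WithBot.add_le_add_natCast_right_iff.1 h2
  refine ⟨.of_maximalIdeal_eq_ofList (l := l₂.map (Ideal.Quotient.mk _)) ?_ (by simpa), 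
    le_antisymm hdim hdim'⟩
  rw [maximalIdeal_quotient, h, Ideal.map_sup, Ideal.map_quotient_self, bot_sup_eq, map_ofList]

/-- A minimal generator of the maximal ideal can be moved inside its class modulo `𝔪²` so as to
avoid the minimal primes. The quotient by it is then a domain by induction on the dimension, and
a minimal prime `p` contained in `(x)` satisfies `p = xp`. -/
theorem IsRegularLocalRing.isDomain_of_ringKrullDim_eq (n : ℕ) : ∀ {R : Type*} [CommRing R]
    [IsRegularLocalRing R], ringKrullDim R = n → IsDomain R := by
  induction n with
  | zero =>
    intro R _ _ hdim
    obtain ⟨l, hl, hdim'⟩ := IsRegularLocalRing.exists_ofList_eq_maximalIdeal R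
    have : l = [] := by
      rw [hdim] at hdim'
      exact List.length_eq_zero_iff.1 (by exact_mod_cast hdim')
    rw [this, ofList_nil] at hl
    exact ((IsLocalRing.isField_iff_maximalIdeal_eq).2 hl.symm).isDomain
  | succ n ih =>
    intro R _ _ hdim₀
    obtain ⟨l', hl, hdim⟩ := IsRegularLocalRing.exists_ofList_eq_maximalIdeal R
    have hlen : l'.length = n + 1 := by
      rw [hdim₀] at hdim
      exact_mod_cast hdim
    obtain ⟨y, l, rfl⟩ := List.exists_cons_of_length_eq_add_one hlen
    have hmin : ∀ Q ∈ minimalPrimes R, ¬ maximalIdeal R ^ 2 ≤ Q := by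
      intro Q hQ hle
      have := hQ.1.1
      have hQm : Q = maximalIdeal R :=
        le_antisymm (le_maximalIdeal this.ne_top) (Ideal.IsPrime.le_of_pow_le hle)
      have hm : (maximalIdeal R).height = 0 := by
        rw [← hQm]; exact Ideal.height_eq_zero_iff.2 hQ
      have := IsLocalRing.maximalIdeal_height_eq_ringKrullDim (R := R)
      rw [hm, ← hdim] at this
      exact Nat.succ_ne_zero l.length (by exact_mod_cast this.symm)
    obtain ⟨c, hc, hcQ⟩ := Ideal.exists_mem_forall_add_notMem
      (minimalPrimes.finite_of_isNoetherianRing R) (fun Q hQ ↦ hQ.1.1) y _ hmin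
    have hcm : c ∈ maximalIdeal R := Ideal.pow_le_self two_ne_zero hc
    have hym : y ∈ maximalIdeal R := hl ▸ Ideal.subset_span (by simp)
    have hgen : maximalIdeal R = ofList ((y + c) :: l) := by
      have hlm : ofList l ≤ maximalIdeal R := by rw [← hl, ofList_cons]; exact le_sup_right
      refine le_antisymm ?_ (by
        rw [ofList_cons, sup_le_iff, Ideal.span_singleton_le_iff_mem]
        exact ⟨add_mem hym hcm, hlm⟩)
      refine Submodule.le_of_le_smul_of_le_jacobson_bot
        (maximalIdeal R).fg_of_isNoetherianRing (I := maximalIdeal R)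
        (by rw [IsLocalRing.jacobson_eq_maximalIdeal _ bot_ne_top]) ?_
      conv_lhs => rw [← hl, ofList_cons]
      rw [ofList_cons, smul_eq_mul, ← sq, sup_le_iff, Ideal.span_singleton_le_iff_mem]
      refine ⟨?_, le_sup_right.trans le_sup_left⟩
      have h1 : y + c ∈ Ideal.span {y + c} ⊔ ofList l ⊔ maximalIdeal R ^ 2 :=
        le_sup_left (α := Ideal R) (le_sup_left (α := Ideal R) (Ideal.mem_span_singleton_self _))
      exact ((Ideal.add_mem_iff_left _ (le_sup_right (α := Ideal R) hc)).1 h1)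
    obtain ⟨hreg, hdim'⟩ := IsRegularLocalRing.quotient_ofList (l₁ := [y + c]) (l₂ := l) hgen hdim
    have hdom := ih (R := R ⧸ ofList [y + c]) (by
      rw [hdim']; exact_mod_cast (by simpa using hlen))
    have hprime : (ofList [y + c]).IsPrime := (Ideal.Quotient.isDomain_iff_prime _).1 hdom
    obtain ⟨p, hp, hpx⟩ := Ideal.exists_minimalPrimes_le (bot_le (a := ofList [y + c]))
    have hpp := hp.1.1
    have hp0 : p = ⊥ := by
      refine Submodule.eq_bot_of_le_smul_of_le_jacobson_bot (Ideal.span {y + c}) p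
        p.fg_of_isNoetherianRing (fun b hb ↦ ?_) ?_
      · obtain ⟨d, rfl⟩ := Ideal.mem_span_singleton'.1 (ofList_singleton (y + c) ▸ hpx hb)
        have hd : d ∈ p := (hpp.mem_or_mem hb).resolve_right (hcQ p hp)
        rw [mul_comm]
        exact Ideal.mul_mem_mul (Ideal.mem_span_singleton_self _) hd
      · rw [IsLocalRing.jacobson_eq_maximalIdeal _ bot_ne_top, Ideal.span_singleton_le_iff_mem]
        exact add_mem hym hcm
    exact (IsDomain.of_bot_isPrime R (hbp := hp0 ▸ hpp))

instance IsRegularLocalRing.isDomain (R : Type*) [CommRing R] [IsRegularLocalRing R] :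
    IsDomain R := by
  obtain ⟨l, hl, hdim⟩ := IsRegularLocalRing.exists_ofList_eq_maximalIdeal R
  exact isDomain_of_ringKrullDim_eq l.length hdim.symm

theorem isSMulRegular_quotient_smul_top_iff {R : Type*} [CommRing R] (I : Ideal R) (x : R) :
    IsSMulRegular (R ⧸ (I • ⊤ : Submodule R R)) x ↔ ∀ a, x * a ∈ I → a ∈ I := by
  rw [isSMulRegular_quotient_iff_mem_of_smul_mem]
  simp

/-- A regular system of parameters is a regular sequence: each successive quotient is a regular
local ring, hence a domain, and the next parameter is nonzero in it for dimension reasons. -/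
theorem IsRegularLocalRing.isWeaklyRegular {R : Type*} [CommRing R] [IsLocalRing R]
    [IsNoetherianRing R] {l : List R} (h : maximalIdeal R = ofList l)
    (hl : (l.length : WithBot ℕ∞) = ringKrullDim R) : IsWeaklyRegular R l := by
  refine ⟨fun i hi ↦ ?_⟩
  have hsplit : l.take i ++ l.drop i = l := List.take_append_drop i l
  obtain ⟨hreg, hdim⟩ := IsRegularLocalRing.quotient_ofList (l₁ := l.take i) (l₂ := l.drop i)
    (by rwa [hsplit]) (by rwa [hsplit])
  have hprime : (ofList (l.take i)).IsPrime := (Ideal.Quotient.isDomain_iff_prime _).1 inferInstance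
  rw [isSMulRegular_quotient_smul_top_iff]
  refine fun a ha ↦ (hprime.mem_or_mem ha).resolve_left fun hmem ↦ ?_
  -- otherwise `l[i]` is superfluous and the dimension drops
  have hgen : maximalIdeal R = ofList (l.take i) ⊔ ofList (l.drop (i + 1)) := by
    conv_lhs => rw [h, ← hsplit, List.drop_eq_getElem_cons hi, ofList_append, ofList_cons,
      ← sup_assoc]
    congr 1
    exact sup_eq_left.2 ((Ideal.span_singleton_le_iff_mem _).2 hmem)
  have := ringKrullDim_quotient_le_of_maximalIdeal_le hprime.ne_top hgen
  rw [hdim, List.length_drop, List.length_drop] at this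
  have : l.length - i ≤ l.length - (i + 1) := by exact_mod_cast this
  omega

open IsLocalRing Ideal RingTheory.Sequence CategoryTheory Abelian

/-! ### Regular sequences and associated primes -/

section Depth

open scoped Pointwise

variable {R : Type*} [CommRing R] [IsLocalRing R] [IsNoetherianRing R]

theorem exists_isAssociatedPrime_of_not_isSMulRegular {R : Type*} [CommRing R]
    [IsNoetherianRing R] {M : Type*} [AddCommGroup M] [Module R M] {x : R}
    (h : ¬ IsSMulRegular M x) : ∃ Q, IsAssociatedPrime Q M ∧ x ∈ Q := by
  have : x ∈ ⋃ p ∈ associatedPrimes R M, (p : Set R) := by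
    rw [biUnion_associatedPrimes_eq_compl_regular]; exact h
  obtain ⟨Q, hQ, h⟩ := Set.mem_iUnion₂.1 this
  exact ⟨Q, hQ, h⟩

theorem IsAssociatedPrime.notMem_of_isSMulRegular {R : Type*} [CommRing R]
    [IsNoetherianRing R] {M : Type*} [AddCommGroup M] [Module R M] {Q : Ideal R}
    (hQ : IsAssociatedPrime Q M) {x : R} (h : IsSMulRegular M x) : x ∉ Q := by
  intro hx
  have : x ∈ ⋃ p ∈ associatedPrimes R M, (p : Set R) := Set.mem_biUnion hQ hx
  rw [biUnion_associatedPrimes_eq_compl_regular] at this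
  exact this h

theorem IsAssociatedPrime.le_of_quotient_smul_top {R : Type*} [CommRing R] {I Q : Ideal R}
    (hQ : IsAssociatedPrime Q (R ⧸ (I • ⊤ : Submodule R R))) : I ≤ Q := by
  refine le_trans (fun b hb ↦ ?_) (IsAssociatedPrime.annihilator_le hQ)
  rw [Submodule.annihilator_top, Module.mem_annihilator]
  intro z
  obtain ⟨z, rfl⟩ := Submodule.mkQ_surjective _ z
  rw [← map_smul, Submodule.mkQ_apply, Submodule.Quotient.mk_eq_zero]
  exact Submodule.smul_mem_smul hb trivial

/-- The elements of `M` killed by `Q` form a nonzero finite module `N`, and an element of `N`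
outside `xN` stays nonzero in `M / xM`. -/
theorem exists_isAssociatedPrime_quotSMulTop {M : Type*} [AddCommGroup M] [Module R M]
    [Module.Finite R M] {Q : Ideal R} (hQ : IsAssociatedPrime Q M) {x : R}
    (hx : x ∈ maximalIdeal R) (hreg : IsSMulRegular M x) :
    ∃ Q' : Ideal R, IsAssociatedPrime Q' (QuotSMulTop x M) ∧ Q ≤ Q' ∧ x ∈ Q' := by
  obtain ⟨hQp, z, hz⟩ := isAssociatedPrime_iff.1 hQ
  let N := Submodule.torsionBySet R M Q
  have hN : N ≠ ⊥ := by
    intro h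
    have hzN : z ∈ N := by
      rw [Submodule.mem_torsionBySet_iff]
      rintro ⟨a, ha⟩
      have ha' : a ∈ (⊥ : Submodule R M).colon {z} := hz ▸ ha
      simpa [Submodule.mem_colon_singleton] using ha'
    rw [h, Submodule.mem_bot] at hzN
    exact hQp.ne_top (by rw [hz, hzN]; simp)
  have hNx : ¬ N ≤ Ideal.span {x} • N := fun h ↦ hN <|
    Submodule.eq_bot_of_le_smul_of_le_jacobson_bot _ N (IsNoetherian.noetherian N) h
      (by rwa [IsLocalRing.jacobson_eq_maximalIdeal _ bot_ne_top,
        Ideal.span_singleton_le_iff_mem])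
  obtain ⟨w, hwN, hw⟩ := Set.not_subset.1 hNx
  have hw0 : (Submodule.Quotient.mk w : QuotSMulTop x M) ≠ 0 := by
    rw [Ne, Submodule.Quotient.mk_eq_zero, Submodule.mem_smul_pointwise_iff_exists]
    rintro ⟨u, -, rfl⟩
    refine hw (Submodule.smul_mem_smul (Ideal.mem_span_singleton_self x) ?_)
    rw [Submodule.mem_torsionBySet_iff]
    intro a
    have := (Submodule.mem_torsionBySet_iff _ _).1 hwN a
    rw [smul_comm] at this
    exact hreg.right_eq_zero_of_smul this
  obtain ⟨Q', hQ', hle⟩ := exists_le_isAssociatedPrime_of_isNoetherianRing R _ hw0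
  refine ⟨Q', hQ', fun a ha ↦ hle ?_, hle ?_⟩
  · rw [Submodule.mem_colon_singleton, ← Submodule.Quotient.mk_smul,
      (Submodule.mem_torsionBySet_iff _ _).1 hwN ⟨a, ha⟩]
    simp
  · rw [Submodule.mem_colon_singleton, ← Submodule.Quotient.mk_smul, Submodule.mem_bot,
      Submodule.Quotient.mk_eq_zero]
    exact Submodule.smul_mem_pointwise_smul _ _ _ trivial

/-- The depth of a finite module bounds the dimension of `R / Q` from below for every associated
prime `Q` of the module. -/
theorem IsAssociatedPrime.length_le_ringKrullDim_quotient {M : Type*} [AddCommGroup M]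
    [Module R M] [Module.Finite R M] {Q : Ideal R} (hQ : IsAssociatedPrime Q M) {l : List R}
    (hl : ∀ r ∈ l, r ∈ maximalIdeal R) (hreg : IsWeaklyRegular M l) :
    (l.length : WithBot ℕ∞) ≤ ringKrullDim (R ⧸ Q) := by
  induction l generalizing M Q with
  | nil =>
    have := Ideal.Quotient.nontrivial_iff.2 hQ.1.ne_top
    simpa using ringKrullDim_nonneg_of_nontrivial (R := R ⧸ Q)
  | cons x l ih =>
    rw [isWeaklyRegular_cons_iff] at hreg
    have hx := hl x (by simp)
    obtain ⟨Q', hQ', hle, hxQ'⟩ := exists_isAssociatedPrime_quotSMulTop hQ hx hreg.1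
    have h := ih hQ' (fun r hr ↦ hl r (by simp [hr])) hreg.2
    have hxQ : x ∉ Q := hQ.notMem_of_isSMulRegular hreg.1
    have := hQ.1
    have h1 := ringKrullDim_succ_le_of_surjective (Ideal.Quotient.factor hle)
      (Ideal.Quotient.factor_surjective hle) (r := Ideal.Quotient.mk Q x)
      (mem_nonZeroDivisors_of_ne_zero (by rwa [Ne, Ideal.Quotient.eq_zero_iff_mem]))
      (by simpa [Ideal.Quotient.eq_zero_iff_mem] using hxQ')
    refine le_trans ?_ h1
    rw [List.length_cons, Nat.cast_add]
    gcongr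
    simp

end Depth

section Lifting

universe u

variable {R : Type u} [CommRing R] [IsLocalRing R] [IsNoetherianRing R]

/-- Dividing by a regular element lowers the depth by at most one; this is the invariance of the
length of maximal regular sequences, read off from the vanishing of `Ext`. -/
theorem exists_isRegular_quotSMulTop {M : Type u} [AddCommGroup M] [Module R M]
    [Module.Finite R M] {n : ℕ} {l : List R} (hlen : l.length = n + 1)
    (hl : ∀ r ∈ l, r ∈ maximalIdeal R) (hreg : IsRegular M l) {x : R}
    (hx : x ∈ maximalIdeal R) (hxreg : IsSMulRegular M x) :
    ∃ l' : List R, l'.length = n ∧ (∀ r ∈ l', r ∈ maximalIdeal R) ∧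
      IsRegular (QuotSMulTop x M) l' := by
  have : Nontrivial M := hreg.nontrivial
  have : Nontrivial (QuotSMulTop x M) := nontrivial_quotSMulTop_of_mem_maximalIdeal M hx
  have hlt : ∀ (L : Type u) [AddCommGroup L] [Module R L] [Module.Finite R L] [Nontrivial L],
      maximalIdeal R • (⊤ : Submodule R L) < ⊤ := by
    intro L _ _ _ _
    refine lt_top_iff_ne_top.2 (Submodule.top_ne_ideal_smul_of_le_jacobson_annihilator ?_).symm
    exact IsLocalRing.maximalIdeal_le_jacobson _
  have h1 : ∀ i < n + 1, Subsingleton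
      (Ext (ModuleCat.of R (Shrink.{u} (R ⧸ maximalIdeal R))) (ModuleCat.of R M) i) := by
    refine ((ModuleCat.exists_isRegular_tfae (maximalIdeal R) (n + 1) (ModuleCat.of R M)
      (hlt M)).out 1 3).2 ?_
    exact ⟨l, hlen, hl, hreg⟩
  refine ((ModuleCat.exists_isRegular_tfae (maximalIdeal R) n
    (ModuleCat.of R (QuotSMulTop x M)) (hlt _)).out 1 3).1 fun i hi ↦ ?_
  have zero1 := AddCommGrpCat.isZero_of_iff_subsingleton.mpr (h1 i (by omega))
  have zero2 := AddCommGrpCat.isZero_of_iff_subsingleton.mpr (h1 (i + 1) (by omega))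
  exact AddCommGrpCat.subsingleton_of_isZero <| ShortComplex.Exact.isZero_of_both_zeros
    ((Ext.covariant_sequence_exact₃' _ (IsSMulRegular.smulShortComplex_shortExact
      (M := ModuleCat.of R M) hxreg)) i (i + 1) rfl)
    (zero1.eq_zero_of_src _) (zero2.eq_zero_of_tgt _)

/-- Lifting generators `as` of `𝔪` modulo `P` to a regular sequence. Along the way no associated
prime can contain `P`, since modulo such a prime `𝔪` is generated by too few elements for the
depth; so the next generator can be corrected by an element of `P`. -/
theorem exists_isWeaklyRegular_lift {P : Ideal R} (hP : P ≤ maximalIdeal R) {as : List R} :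
    ∀ {M : Type u} [AddCommGroup M] [Module R M] [Module.Finite R M],
    (∀ a ∈ as, a ∈ maximalIdeal R) →
    maximalIdeal R ≤ P ⊔ Module.annihilator R M ⊔ ofList as →
    (∃ l : List R, l.length = as.length + 1 ∧ (∀ r ∈ l, r ∈ maximalIdeal R) ∧ IsRegular M l) →
    ∃ rs : List R, List.Forall₂ (fun r a ↦ r - a ∈ P) rs as ∧ IsWeaklyRegular M rs ∧
      ∃ y ∈ maximalIdeal R, IsSMulRegular (M ⧸ (ofList rs • ⊤ : Submodule R M)) y := by
  induction as with
  | nil =>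
    rintro M _ _ _ - - ⟨l, hlen, hl, hreg⟩
    obtain ⟨y, rfl⟩ := List.length_eq_one_iff.1 hlen
    refine ⟨[], .nil, .nil R M, y, hl y (by simp), ?_⟩
    have := (isWeaklyRegular_append_iff M [] [y]).1 hreg.1
    exact (isWeaklyRegular_singleton_iff _ _).1 this.2
  | cons a as ih =>
    rintro M _ _ _ has hm ⟨l, hlen, hl, hreg⟩
    have ham := has a (by simp)
    have hass : ∀ Q ∈ associatedPrimes R M, ¬ P ≤ Q := by
      intro Q hQ hPQ
      have hann : Module.annihilator R M ≤ Q := by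
        rw [← Submodule.annihilator_top]; exact IsAssociatedPrime.annihilator_le hQ
      have h1 := hQ.length_le_ringKrullDim_quotient hl hreg.1
      have h2 := ringKrullDim_quotient_le_of_maximalIdeal_le hQ.1.ne_top (l := a :: as)
        (le_antisymm (hm.trans (sup_le_sup_right (sup_le hPQ hann) _))
          (sup_le (le_maximalIdeal hQ.1.ne_top) (Ideal.span_le.2 has)))
      have : l.length ≤ (a :: as).length := by exact_mod_cast h1.trans h2
      omega
    obtain ⟨c, hc, hcQ⟩ := Ideal.exists_mem_forall_add_notMem
      (associatedPrimes.finite R M) (fun Q hQ ↦ hQ.1) a P hass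
    have hreg' : IsSMulRegular M (a + c) := by
      by_contra hcon
      obtain ⟨Q, hQ, h⟩ := exists_isAssociatedPrime_of_not_isSMulRegular hcon
      exact hcQ Q hQ h
    have hacm : a + c ∈ maximalIdeal R := add_mem ham (hP hc)
    obtain ⟨rs, h₁, h₂, y, hy, hyreg⟩ := ih (M := QuotSMulTop (a + c) M)
      (fun b hb ↦ has b (by simp [hb])) (by
        refine hm.trans ?_
        have hann : Module.annihilator R M ≤ Module.annihilator R (QuotSMulTop (a + c) M) :=
          LinearMap.annihilator_le_of_surjective _ (Submodule.mkQ_surjective _)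
        have hac : a + c ∈ P ⊔ Module.annihilator R (QuotSMulTop (a + c) M) ⊔ ofList as :=
          le_sup_left (α := Ideal R) (le_sup_right (α := Ideal R)
            (QuotSMulTop.mem_annihilator M (a + c)))
        have hcm : c ∈ P ⊔ Module.annihilator R (QuotSMulTop (a + c) M) ⊔ ofList as :=
          le_sup_left (α := Ideal R) (le_sup_left (α := Ideal R) hc)
        rw [ofList_cons]
        refine sup_le (sup_le_sup_right ?_ _ |>.trans' le_sup_left) (sup_le ?_ le_sup_right)
        · exact sup_le_sup_left hann _
        · rw [Ideal.span_singleton_le_iff_mem]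
          exact (Ideal.add_mem_iff_left _ hcm).1 hac)
      (exists_isRegular_quotSMulTop hlen hl hreg hacm hreg')
    refine ⟨(a + c) :: rs, .cons (by simpa) h₁, .cons hreg' h₂, y, hy, ?_⟩
    exact ((Submodule.quotOfListConsSMulTopEquivQuotSMulTopInner M (a + c) rs).isSMulRegular_congr
      y).2 hyreg

theorem sup_ofList_le_of_forall₂ {R : Type*} [CommRing R] {P : Ideal R} {rs as : List R}
    (h : List.Forall₂ (fun r a ↦ r - a ∈ P) rs as) : P ⊔ ofList as ≤ P ⊔ ofList rs := by
  induction h with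
  | nil => rfl
  | @cons r a rs as hra _ ih =>
    rw [ofList_cons, ofList_cons]
    refine sup_le le_sup_left (sup_le ?_ ?_)
    · rw [Ideal.span_singleton_le_iff_mem]
      have h1 : r - a ∈ P ⊔ (Ideal.span {r} ⊔ ofList rs) := le_sup_left (α := Ideal R) hra
      have h2 : r ∈ P ⊔ (Ideal.span {r} ⊔ ofList rs) := le_sup_right (α := Ideal R)
        (le_sup_left (α := Ideal R) (Ideal.mem_span_singleton_self r))
      simpa using sub_mem h2 h1
    · exact (le_sup_right.trans ih).trans (sup_le_sup_left le_sup_right _)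

/-- The regular sequence lifting `as` extends by an element of `P` that is a minimal generator of
`𝔪` modulo the sequence. -/
theorem exists_isWeaklyRegular_append_singleton {P : Ideal R} (hP : P ≤ maximalIdeal R)
    {as : List R} (has : ∀ a ∈ as, a ∈ maximalIdeal R) (hm : maximalIdeal R ≤ P ⊔ ofList as)
    {l : List R} (hlen : l.length = as.length + 1) (hl : ∀ r ∈ l, r ∈ maximalIdeal R)
    (hreg : IsRegular R l) :
    ∃ (rs : List R) (x : R), List.Forall₂ (fun r a ↦ r - a ∈ P) rs as ∧
      maximalIdeal R = P ⊔ ofList rs ∧ x ∈ P ∧ x ∉ ofList rs ⊔ maximalIdeal R ^ 2 ∧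
      IsWeaklyRegular R (rs ++ [x]) := by
  obtain ⟨rs, h₁, h₂, y, hy, hyreg⟩ := exists_isWeaklyRegular_lift (M := R) hP has
    (hm.trans (sup_le_sup_right le_sup_left _)) ⟨l, hlen, hl, hreg⟩
  have hrs : ofList rs ≤ maximalIdeal R := by
    clear h₂ hyreg hm hlen
    induction h₁ with
    | nil => simp
    | @cons r a rs as hra _ ih =>
      rw [ofList_cons, sup_le_iff, Ideal.span_singleton_le_iff_mem]
      refine ⟨?_, ih fun b hb ↦ has b (by simp [hb])⟩
      simpa using add_mem (hP hra) (has a (by simp))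
  have hm' : maximalIdeal R = P ⊔ ofList rs :=
    le_antisymm (hm.trans (sup_ofList_le_of_forall₂ h₁)) (sup_le hP hrs)
  have hP2 : ¬ P ≤ ofList rs ⊔ maximalIdeal R ^ 2 := by
    intro hle
    have h := Submodule.le_of_le_smul_of_le_jacobson_bot
      (maximalIdeal R).fg_of_isNoetherianRing (I := maximalIdeal R) (N := ofList rs)
      (by rw [IsLocalRing.jacobson_eq_maximalIdeal _ bot_ne_top]) (by
        rw [smul_eq_mul, ← sq]
        exact hm'.le.trans (sup_le hle le_sup_left))
    rw [isSMulRegular_quotient_smul_top_iff] at hyreg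
    have := hyreg 1 (by simpa using h hy)
    exact Ideal.IsPrime.ne_top' (top_le_iff.1 (((Ideal.eq_top_iff_one _).2 this).ge.trans hrs))
  obtain ⟨x₀, hx₀, hx₀2⟩ := SetLike.not_le_iff_exists.1 hP2
  have hass : ∀ Q ∈ associatedPrimes R (R ⧸ (ofList rs • ⊤ : Submodule R R)), ¬ P * maximalIdeal R ≤ Q := by
    intro Q hQ hle
    have hQp := hQ.1
    have hrsQ : ofList rs ≤ Q := hQ.le_of_quotient_smul_top
    have hQm : maximalIdeal R ≤ Q := by
      rcases hQp.mul_le.1 hle with h | h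
      · exact hm'.le.trans (sup_le h hrsQ)
      · exact h
    exact hQ.notMem_of_isSMulRegular hyreg (hQm hy)
  obtain ⟨c, hc, hcQ⟩ := Ideal.exists_mem_forall_add_notMem
    (associatedPrimes.finite R _) (fun Q hQ ↦ hQ.1) x₀ _ hass
  have hcm : c ∈ maximalIdeal R ^ 2 := by
    rw [sq]; exact Ideal.mul_mono hP le_rfl hc
  have hcP : c ∈ P := Ideal.mul_le_left hc
  have hxP : x₀ + c ∈ P := P.add_mem hx₀ hcP
  have hx2 : x₀ + c ∉ ofList rs ⊔ maximalIdeal R ^ 2 := fun h ↦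
    hx₀2 ((Ideal.add_mem_iff_left _ (Ideal.mem_sup_right hcm)).1 h)
  refine ⟨rs, x₀ + c, h₁, hm', hxP, hx2, ?_⟩
  rw [isWeaklyRegular_append_iff, isWeaklyRegular_singleton_iff]
  refine ⟨h₂, ?_⟩
  by_contra hcon
  obtain ⟨Q, hQ, h⟩ := exists_isAssociatedPrime_of_not_isSMulRegular hcon
  exact hcQ Q hQ h

end Lifting

theorem IsCohenMacaulayLocalRing.exists_isRegular {R : Type*} [CommRing R]
    [IsCohenMacaulayLocalRing R] {n : ℕ} (h : ringKrullDim R = n) :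
    ∃ l : List R, l.length = n ∧ (∀ r ∈ l, r ∈ maximalIdeal R) ∧ IsRegular R l := by
  have hd : localDepth R = n := by
    have := (IsCohenMacaulayLocalRing.depth_eq_dim (R := R)).trans h
    exact_mod_cast this
  have hex : ∃ l : List R, n ≤ l.length ∧ (∀ r ∈ l, r ∈ maximalIdeal R) ∧ IsRegular R l := by
    by_contra! hcon
    rcases n with _ | n
    · exact hcon [] (by simp) (by simp) (.nil R R)
    have : localDepth R ≤ n := by
      refine iSup₂_le fun l hl ↦ ?_
      by_contra! hlt
      exact hcon l (by exact_mod_cast (ENat.add_one_le_iff (by simp)).2 hlt) hl.1 hl.2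
    rw [hd] at this
    exact absurd (by exact_mod_cast this : n + 1 ≤ n) (by omega)
  obtain ⟨l, hn, hl, hreg⟩ := hex
  refine ⟨l.take n, by simpa, fun r hr ↦ hl r (List.mem_of_mem_take hr), ?_⟩
  rw [isRegular_iff_isWeaklyRegular_of_subset_maximalIdeal
    fun r hr ↦ hl r (List.mem_of_mem_take hr)]
  have := hreg.1
  rw [← List.take_append_drop n l, isWeaklyRegular_append_iff] at this
  exact this.1

/-! ### Injective dimension and regular sequences -/

section Ext

universe u

variable {A : Type u} [CommRing A]

/-- The sequence `0 → A / K → A / J → A / L → 0` with first map multiplication by `a`, where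
`K = (J : a)` and `L = J + (a)`. The ideals `K` and `L` are separate arguments, so that the terms
can be matched with given quotients of `A`. -/
noncomputable def colonShortComplex {J K L : Ideal A} (a : A) (hK : J.colon {a} = K)
    (hL : J ⊔ Ideal.span {a} = L) : ShortComplex (ModuleCat.{u} A) :=
  ModuleCat.shortComplexOfCompEqZero
    (Submodule.mapQ K J (LinearMap.lsmul A A a) (by
      intro b hb
      rw [← hK, Submodule.mem_colon_singleton, smul_eq_mul, mul_comm] at hb
      exact hb))
    (Submodule.factor (hL ▸ le_sup_left : J ≤ L)) (by
      refine LinearMap.ext fun b ↦ ?_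
      obtain ⟨b, rfl⟩ := Submodule.mkQ_surjective _ b
      have : a ∈ L := hL ▸ Ideal.mem_sup_right (Ideal.mem_span_singleton_self a)
      exact (Submodule.Quotient.mk_eq_zero L).2 (L.mul_mem_right b this))

theorem colonShortComplex_shortExact {J K L : Ideal A} (a : A) (hK : J.colon {a} = K)
    (hL : J ⊔ Ideal.span {a} = L) : (colonShortComplex a hK hL).ShortExact := by
  apply ModuleCat.shortComplex_shortExact
  · intro b
    obtain ⟨b, rfl⟩ := Submodule.mkQ_surjective _ b
    constructor
    · intro h
      have hb : b ∈ L := (Submodule.Quotient.mk_eq_zero L).1 h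
      rw [← hL, Submodule.mem_sup] at hb
      obtain ⟨j, hj, c, hc, rfl⟩ := hb
      obtain ⟨c, rfl⟩ := Ideal.mem_span_singleton'.1 hc
      refine ⟨Submodule.Quotient.mk c, ((Submodule.Quotient.eq J).2 ?_ :
        (Submodule.Quotient.mk (a * c) : A ⧸ J) = Submodule.Quotient.mk (j + c * a))⟩
      have : a * c - (j + c * a) = - j := by ring
      rw [this]; exact neg_mem hj
    · rintro ⟨c, h⟩
      obtain ⟨c, rfl⟩ := Submodule.mkQ_surjective _ c
      have h' : (a * c) - b ∈ J := (Submodule.Quotient.eq J).1 h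
      refine (Submodule.Quotient.mk_eq_zero L).2 ?_
      have h1 : a * c - b ∈ L := hL ▸ Ideal.mem_sup_left h'
      have h2 : a ∈ L := hL ▸ Ideal.mem_sup_right (Ideal.mem_span_singleton_self a)
      simpa using sub_mem (L.mul_mem_right c h2) h1
  · refine (injective_iff_map_eq_zero (colonShortComplex a hK hL).f.hom).2 fun b h ↦ ?_
    obtain ⟨b, rfl⟩ := Submodule.mkQ_surjective _ b
    have hb : a * b ∈ J := (Submodule.Quotient.mk_eq_zero J).1 h
    refine (Submodule.Quotient.mk_eq_zero K).2 ?_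
    rw [← hK, Submodule.mem_colon_singleton, smul_eq_mul, mul_comm]
    exact hb
  · exact Submodule.factor_surjective (hL ▸ le_sup_left : J ≤ L)

theorem subsingleton_ext_of_subsingleton {N : ModuleCat.{u} A} [Subsingleton N]
    (M : ModuleCat.{u} A) (i : ℕ) : Subsingleton (Ext N M i) := by
  have hN : 𝟙 N = 0 := (ModuleCat.isZero_of_subsingleton N).eq_of_src _ _
  refine subsingleton_of_forall_eq 0 fun e ↦ ?_
  rw [← Ext.mk₀_id_comp e, hN, Ext.mk₀_zero, Ext.zero_comp]

/-- Injective dimension is detected by the cyclic modules, by Baer's criterion applied to a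
cosyzygy. -/
theorem hasInjectiveDimensionLE_of_subsingleton_ext_quotient (n : ℕ) (M : ModuleCat.{u} A)
    (h : ∀ I : Ideal A, Subsingleton (Ext (ModuleCat.of A (A ⧸ I)) M (n + 1))) :
    HasInjectiveDimensionLE M n := by
  induction n generalizing M with
  | zero =>
    simp only [HasInjectiveDimensionLE, zero_add, ← injective_iff_hasInjectiveDimensionLT_one,
      ← Module.injective_iff_injective_object A M]
    refine Module.Baer.injective fun I g ↦ ?_
    let S : ShortComplex (ModuleCat.{u} A) := ModuleCat.shortComplexOfCompEqZero I.subtype I.mkQ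
      (LinearMap.exact_subtype_mkQ I).linearMap_comp_eq_zero
    have hS : S.ShortExact := ModuleCat.shortComplex_shortExact S
      (LinearMap.exact_subtype_mkQ I) I.injective_subtype (Submodule.mkQ_surjective _)
    obtain ⟨x, hx⟩ := Ext.contravariant_sequence_exact₁ hS M
      (Ext.mk₀ (ModuleCat.ofHom g : S.X₁ ⟶ M)) (add_zero 1) ((h I).elim _ _)
    obtain ⟨φ, rfl⟩ := (Ext.mk₀_bijective _ _).2 x
    rw [Ext.mk₀_comp_mk₀] at hx
    have hφ := (Ext.mk₀_bijective _ _).1 hx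
    refine ⟨φ.hom, fun x hx ↦ ?_⟩
    exact congrArg (fun ψ : S.X₁ ⟶ M ↦ ψ.hom ⟨x, hx⟩) hφ
  | succ n ih =>
    let ⟨J, _, f, _⟩ := EnoughInjectives.presentation M
    let S := ShortComplex.mk f (Limits.cokernel.π f) (Limits.cokernel.condition f)
    have hS : S.ShortExact := { exact := ShortComplex.exact_cokernel f }
    have h2 : Injective S.X₂ := inferInstanceAs (Injective J)
    refine (hS.hasInjectiveDimensionLT_X₃_iff n h2).1 (ih S.X₃ fun I ↦ ?_)
    refine subsingleton_of_forall_eq 0 fun e ↦ ?_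
    obtain ⟨e₂, rfl⟩ := Ext.covariant_sequence_exact₃ _ hS e rfl ((h I).elim _ _)
    rw [Ext.eq_zero_of_injective e₂, Ext.zero_comp]

theorem subsingleton_ext_of_shortExact {S : ShortComplex (ModuleCat.{u} A)} (hS : S.ShortExact)
    {M : ModuleCat.{u} A} {i : ℕ} (h₁ : Subsingleton (Ext S.X₁ M i))
    (h₃ : Subsingleton (Ext S.X₃ M i)) : Subsingleton (Ext S.X₂ M i) := by
  refine subsingleton_of_forall_eq 0 fun e ↦ ?_
  obtain ⟨e₃, rfl⟩ := Ext.contravariant_sequence_exact₂ hS M e (h₁.elim _ _)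
  rw [h₃.elim e₃ 0, Ext.comp_zero]

/-- Dimension shifting along `0 → M → M → M / xM → 0`, natural in the first argument of `Ext` on
modules killed by `x`: the connecting maps are then bijective. -/
theorem surjective_mk₀_comp_iff_quotSMulTop {M : ModuleCat.{u} A} {x : A}
    (hx : IsSMulRegular M x) {N' N : ModuleCat.{u} A} (ι : N' ⟶ N)
    (hN' : x ∈ Module.annihilator A N') (hN : x ∈ Module.annihilator A N) {n : ℕ}
    (h' : Subsingleton (Ext N' M n)) (h : Subsingleton (Ext N M n)) :
    (Function.Surjective fun e : Ext N M (n + 1) ↦ (Ext.mk₀ ι).comp e (zero_add (n + 1))) ↔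
      Function.Surjective fun e : Ext N (ModuleCat.of A (QuotSMulTop x M)) n ↦
        (Ext.mk₀ ι).comp e (zero_add n) := by
  have hS := hx.smulShortComplex_shortExact
  have key : ∀ L : ModuleCat.{u} A, x ∈ Module.annihilator A L → Subsingleton (Ext L M n) →
      Function.Bijective fun e : Ext L (ModuleCat.of A (QuotSMulTop x M)) n ↦
        e.comp hS.extClass rfl := by
    intro L hL hLM
    constructor
    · refine (injective_iff_map_eq_zero (hS.extClass.postcomp L rfl)).2 fun e he ↦ ?_
      obtain ⟨e₂, rfl⟩ := Ext.covariant_sequence_exact₃ _ hS e rfl he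
      have h0 : e₂ = 0 := hLM.elim _ _
      rw [h0, Ext.zero_comp]
    · intro e
      refine Ext.covariant_sequence_exact₁ _ hS e ?_ rfl
      exact congrArg (fun φ ↦ φ.hom e) (Ext.postcomp_smul_id_eq_zero_of_mem_annihilator hL (n + 1))
  have comm : ∀ e : Ext N (ModuleCat.of A (QuotSMulTop x M)) n,
      (Ext.mk₀ ι).comp (e.comp hS.extClass (rfl : n + 1 = n + 1)) (zero_add _) =
        ((Ext.mk₀ ι).comp e (zero_add n)).comp hS.extClass rfl := fun e ↦
    (Ext.comp_assoc _ _ _ _ _ (by omega)).symm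
  constructor
  · intro hsurj e'
    obtain ⟨e, he⟩ := hsurj (e'.comp hS.extClass rfl)
    obtain ⟨e, rfl⟩ := (key N hN h).2 e
    refine ⟨e, (key N' hN' h').1 ?_⟩
    exact (comm e).symm.trans he
  · intro hsurj e'
    obtain ⟨e', rfl⟩ := (key N' hN' h').2 e'
    obtain ⟨e, rfl⟩ := hsurj e'
    exact ⟨_, comm e⟩

theorem surjective_comp_iff_of_iso {C : Type*} [Category* C] {X Y Z Z' : C} (ι : X ⟶ Y)
    (e : Z ≅ Z') : (Function.Surjective fun ψ : Y ⟶ Z ↦ ι ≫ ψ) ↔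
      Function.Surjective fun ψ : Y ⟶ Z' ↦ ι ≫ ψ := by
  constructor
  · intro h φ
    obtain ⟨ψ, hψ⟩ := h (φ ≫ e.inv)
    exact ⟨ψ ≫ e.hom, by simpa using congrArg (· ≫ e.hom) hψ⟩
  · intro h φ
    obtain ⟨ψ, hψ⟩ := h (φ ≫ e.hom)
    exact ⟨ψ ≫ e.inv, by simpa using congrArg (· ≫ e.inv) hψ⟩

/-- For a regular sequence `rs` on `M` of length `d` killing `N` and `N'`, the isomorphism
`Extᵈ(N, M) ≃ Hom(N, M / rs M)` is natural; only the resulting comparison of the maps induced by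
`N' ⟶ N` is recorded. -/
theorem surjective_mk₀_comp_iff_of_isRegular [IsNoetherianRing A] (rs : List A) :
    ∀ (M : ModuleCat.{u} A) [Module.Finite A M], IsRegular M rs →
    ∀ {N' N : ModuleCat.{u} A} [Module.Finite A N'] [Module.Finite A N] (ι : N' ⟶ N),
    (∀ r ∈ rs, r ∈ Module.annihilator A N') → (∀ r ∈ rs, r ∈ Module.annihilator A N) →
    ((Function.Surjective fun e : Ext N M rs.length ↦ (Ext.mk₀ ι).comp e (zero_add rs.length)) ↔
      Function.Surjective fun ψ : N ⟶ ModuleCat.of A (M ⧸ (ofList rs • ⊤ : Submodule A M)) ↦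
        ι ≫ ψ) := by
  induction rs with
  | nil =>
    intro M _ _ N' N _ _ ι _ _
    let e : M ≅ ModuleCat.of A (M ⧸ (ofList ([] : List A) • ⊤ : Submodule A M)) :=
      (Submodule.quotEquivOfEqBot _ (by simp)).toModuleIso.symm
    rw [← surjective_comp_iff_of_iso ι e]
    constructor
    · intro h φ
      obtain ⟨x, hx⟩ := h (Ext.mk₀ φ)
      obtain ⟨ψ, rfl⟩ := (Ext.mk₀_bijective _ _).2 x
      exact ⟨ψ, (Ext.mk₀_bijective _ _).1 ((Ext.mk₀_comp_mk₀ ι ψ).symm.trans hx)⟩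
    · intro h x
      obtain ⟨φ, rfl⟩ := (Ext.mk₀_bijective _ _).2 x
      obtain ⟨ψ, rfl⟩ := h φ
      exact ⟨Ext.mk₀ ψ, Ext.mk₀_comp_mk₀ ι ψ⟩
  | cons x rs ih =>
    intro M _ hreg N' N _ _ ι hN' hN
    have van : ∀ (L : ModuleCat.{u} A) [Module.Finite A L],
        (∀ r ∈ x :: rs, r ∈ Module.annihilator A L) → Subsingleton (Ext L M rs.length) := by
      intro L _ hL
      refine ModuleCat.subsingleton_ext_of_exists_isRegular (ofList (x :: rs)) L ?_ M
        hreg.top_ne_smul.symm.lt_top (x :: rs) (fun r hr ↦ Ideal.subset_span hr) hreg _ (by simp)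
      rw [Module.support_eq_zeroLocus]
      exact PrimeSpectrum.zeroLocus_anti_mono (Ideal.span_le.2 hL)
    rw [isRegular_cons_iff] at hreg
    have h1 := surjective_mk₀_comp_iff_quotSMulTop hreg.1 ι (hN' x (by simp)) (hN x (by simp))
      (van N' hN') (van N hN)
    rw [List.length_cons, h1, ih (ModuleCat.of A (QuotSMulTop x M)) hreg.2 ι
      (fun r hr ↦ hN' r (by simp [hr])) (fun r hr ↦ hN r (by simp [hr]))]
    exact (surjective_comp_iff_of_iso ι
      (Submodule.quotOfListConsSMulTopEquivQuotSMulTopInner M x rs).toModuleIso).symm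

variable [IsLocalRing A] [IsNoetherianRing A]

theorem subsingleton_ext_quotient_ofList {rs : List A} (hreg : IsRegular A rs)
    (M : ModuleCat.{u} A) {i : ℕ} (hi : rs.length < i) :
    Subsingleton (Ext (ModuleCat.of A (A ⧸ ofList rs)) M i) := by
  have h : projectiveDimension (ModuleCat.of A (A ⧸ ofList rs)) = rs.length := by
    rw [← ModuleCat.projectiveDimension_quotient_eq_length.{u} rs hreg]
    exact projectiveDimension_eq_of_iso (Shrink.linearEquiv A (A ⧸ ofList rs)).symm.toModuleIso
  have : HasProjectiveDimensionLT (ModuleCat.of A (A ⧸ ofList rs)) i := by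
    rw [← projectiveDimension_lt_iff, h]
    exact_mod_cast hi
  exact HasProjectiveDimensionLT.subsingleton _ i i le_rfl M

theorem exists_colon_singleton_eq_maximalIdeal {J : Ideal A} (hJ : J ≠ ⊤)
    (h : ∀ Q : Ideal A, Q.IsPrime → J ≤ Q → Q = maximalIdeal A) :
    ∃ u, J.colon {u} = maximalIdeal A := by
  have : Nontrivial (A ⧸ J) := Ideal.Quotient.nontrivial_iff.2 hJ
  obtain ⟨Q, hQ⟩ := associatedPrimes.nonempty A (A ⧸ J)
  obtain ⟨hQp, z, hz⟩ := isAssociatedPrime_iff.1 hQ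
  obtain ⟨u, rfl⟩ := Submodule.mkQ_surjective _ z
  have hu : J.colon {u} = Q := by
    ext b
    rw [hz, Submodule.mem_colon_singleton, Submodule.mem_colon_singleton, ← map_smul,
      Submodule.mem_bot, Submodule.mkQ_apply, Submodule.Quotient.mk_eq_zero]
  refine ⟨u, hu.trans (h Q hQp fun b hb ↦ ?_)⟩
  rw [← hu, Submodule.mem_colon_singleton]
  exact J.mul_mem_right _ hb

/-- Over a local ring, if `M` has finite injective dimension and `A / q` has finite length, then
`Extⁱ(-, M)` vanishes on all quotients of `A / q` in every degree above which it vanishes on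
`A / q` itself. Descending induction on the degree: the residue field embeds in `A / q`. -/
theorem subsingleton_ext_quotient_of_le {M : ModuleCat.{u} A} {n d : ℕ}
    [HasInjectiveDimensionLT M n] {q : Ideal A} (hq : q ≠ ⊤)
    (hmax : ∀ Q : Ideal A, Q.IsPrime → q ≤ Q → Q = maximalIdeal A)
    (hd : ∀ i, d < i → Subsingleton (Ext (ModuleCat.of A (A ⧸ q)) M i)) (k : ℕ) :
    ∀ i, d < i → n ≤ i + k → ∀ J, q ≤ J → Subsingleton (Ext (ModuleCat.of A (A ⧸ J)) M i) := by
  induction k with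
  | zero => exact fun i _ hi J _ ↦ HasInjectiveDimensionLT.subsingleton M n i hi _
  | succ k ih =>
    intro i hi hn
    have hres : Subsingleton (Ext (ModuleCat.of A (A ⧸ maximalIdeal A)) M i) := by
      obtain ⟨u, hu⟩ := exists_colon_singleton_eq_maximalIdeal hq hmax
      have hS := colonShortComplex_shortExact u hu rfl
      refine subsingleton_of_forall_eq 0 fun e ↦ ?_
      obtain ⟨e₂, rfl⟩ := Ext.contravariant_sequence_exact₁ hS M e (add_comm 1 i)
        ((ih (i + 1) (by omega) (by omega) (q ⊔ Ideal.span {u}) le_sup_left).elim _ _)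
      have h0 : e₂ = 0 := (hd i hi).elim _ _
      rw [h0, Ext.comp_zero]
      rfl
    intro J
    induction J using IsNoetherian.induction with
    | hgt J ihJ =>
    intro hqJ
    by_cases hJ : J = ⊤
    · subst hJ
      have : Subsingleton (A ⧸ (⊤ : Ideal A)) := Ideal.Quotient.subsingleton_iff.2 rfl
      exact subsingleton_ext_of_subsingleton (N := ModuleCat.of A (A ⧸ (⊤ : Ideal A))) M i
    obtain ⟨u, hu⟩ := exists_colon_singleton_eq_maximalIdeal hJ
      fun Q hQ hle ↦ hmax Q hQ (hqJ.trans hle)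
    have huJ : u ∉ J := by
      intro h
      refine (Ideal.IsPrime.ne_top' : maximalIdeal A ≠ ⊤) ?_
      rw [← hu, Ideal.eq_top_iff_one, Submodule.mem_colon_singleton, one_smul]
      exact h
    have hlt : J < J ⊔ Ideal.span {u} := by
      refine lt_of_le_of_ne le_sup_left fun h ↦ huJ ?_
      rw [h]; exact Ideal.mem_sup_right (Ideal.mem_span_singleton_self u)
    exact subsingleton_ext_of_shortExact (colonShortComplex_shortExact u hu rfl) hres
      (ihJ _ hlt (hqJ.trans le_sup_left))

/-- If `A` has finite injective dimension over itself and `rs` generates an `𝔪`-primary ideal `q`,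
then `A / q` is self-injective, in the form: `Ann v ⊆ Ann w` in `A / q` forces `w ∈ (v)`. The map
`v ↦ w` extends to `A / q` because `Hom(-, A / q) ≃ Extᵈ(-, A)` and `Extᵈ⁺¹(A / (q, v), A) = 0`. -/
theorem mem_sup_span_of_hasInjectiveDimensionLE {n : ℕ}
    [HasInjectiveDimensionLE (ModuleCat.of A A) n] {rs : List A} (hreg : IsRegular A rs)
    (hmax : ∀ Q : Ideal A, Q.IsPrime → ofList rs ≤ Q → Q = maximalIdeal A) {v w : A}
    (h : ∀ a, a * v ∈ ofList rs → a * w ∈ ofList rs) : w ∈ ofList rs ⊔ Ideal.span {v} := by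
  have hq : ofList rs ≠ ⊤ := by simpa using hreg.top_ne_smul.symm
  have hS := colonShortComplex_shortExact v (J := ofList rs) rfl rfl
  have hle : ofList rs ≤ (ofList rs).colon {v} := by
    intro b hb
    rw [Submodule.mem_colon_singleton]
    exact Ideal.mul_mem_right _ _ hb
  have hann : ∀ I : Ideal A, ofList rs ≤ I → ∀ r ∈ rs, r ∈ Module.annihilator A (A ⧸ I) :=
    fun I hI r hr ↦ by rw [Ideal.annihilator_quotient]; exact hI (Ideal.subset_span hr)
  have hsurj := (surjective_mk₀_comp_iff_of_isRegular rs (ModuleCat.of A A) hreg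
    (N' := ModuleCat.of A (A ⧸ (ofList rs).colon {v})) (N := ModuleCat.of A (A ⧸ ofList rs))
    (colonShortComplex v rfl rfl).f (hann _ hle) (hann _ le_rfl)).1 fun e ↦
      Ext.contravariant_sequence_exact₁ hS _ e (add_comm 1 _)
        ((subsingleton_ext_quotient_of_le hq hmax (n := n + 1)
          (fun i hi ↦ subsingleton_ext_quotient_ofList hreg _ hi) (n + 1) _ (Nat.lt_succ_self _)
          (by omega) _ le_sup_left).elim _ _)
  let φ : (A ⧸ (ofList rs).colon {v}) →ₗ[A] (A ⧸ (ofList rs • ⊤ : Submodule A A)) :=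
    Submodule.mapQ _ _ (LinearMap.lsmul A A w) fun b hb ↦ by
      rw [Submodule.mem_colon_singleton] at hb
      have := h b hb
      rw [mul_comm] at this
      simpa using this
  obtain ⟨ψ, hψ⟩ := hsurj (ModuleCat.ofHom φ)
  obtain ⟨c, hc⟩ := Submodule.mkQ_surjective _ (ψ.hom (Submodule.Quotient.mk 1))
  have h1 : ψ.hom (Submodule.Quotient.mk (v * 1)) = Submodule.Quotient.mk (w * 1) :=
    congrArg (fun χ ↦ χ.hom (Submodule.Quotient.mk 1 : A ⧸ (ofList rs).colon {v})) hψ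
  have h2 : ψ.hom (Submodule.Quotient.mk (v * 1)) = Submodule.Quotient.mk (v * c) := by
    rw [← smul_eq_mul, Submodule.Quotient.mk_smul, map_smul, ← hc]
    rfl
  have h3 : w * 1 - v * c ∈ (ofList rs • ⊤ : Submodule A A) :=
    (Submodule.Quotient.eq _).1 (h1.symm.trans h2)
  rw [smul_eq_mul, Ideal.mul_top, mul_one] at h3
  have h4 : w - v * c ∈ ofList rs ⊔ Ideal.span {v} := Ideal.mem_sup_left h3
  have h5 : v * c ∈ ofList rs ⊔ Ideal.span {v} :=
    Ideal.mem_sup_right (Ideal.mul_mem_right c _ (Ideal.mem_span_singleton_self v))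
  simpa using add_mem h4 h5

/-- If a module has vanishing `Ext` from the residue field in all degrees above `d`, it has
injective dimension at most `d`: noetherian induction on `I` for `A / I`, with Nakayama's lemma
when some element of `𝔪` is regular on `A / I`. -/
theorem hasInjectiveDimensionLE_of_subsingleton_ext_residueField {M : ModuleCat.{u} A}
    [Module.Finite A M] {d : ℕ}
    (h : ∀ i, d < i → Subsingleton (Ext (ModuleCat.of A (A ⧸ maximalIdeal A)) M i)) :
    HasInjectiveDimensionLE M d := by
  suffices H : ∀ I : Ideal A, ∀ i, d < i → Subsingleton (Ext (ModuleCat.of A (A ⧸ I)) M i) from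
    hasInjectiveDimensionLE_of_subsingleton_ext_quotient d M fun I ↦ H I _ (Nat.lt_succ_self d)
  intro I
  induction I using IsNoetherian.induction with
  | hgt I ih =>
  intro i hi
  by_cases hI : I = ⊤
  · subst hI
    have : Subsingleton (A ⧸ (⊤ : Ideal A)) := Ideal.Quotient.subsingleton_iff.2 rfl
    exact subsingleton_ext_of_subsingleton (N := ModuleCat.of A (A ⧸ (⊤ : Ideal A))) M i
  by_cases hIm : maximalIdeal A ≤ I
  · rw [le_antisymm (le_maximalIdeal hI) hIm]
    exact h i hi
  obtain ⟨a, ham, haI⟩ := SetLike.not_le_iff_exists.1 hIm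
  have hlt : I < I ⊔ Ideal.span {a} := by
    refine lt_of_le_of_ne le_sup_left fun h ↦ haI ?_
    rw [h]; exact Ideal.mem_sup_right (Ideal.mem_span_singleton_self a)
  by_cases hcol : I.colon {a} = I
  · have hS := colonShortComplex_shortExact a hcol rfl
    by_contra hne
    rw [not_subsingleton_iff_nontrivial] at hne
    have hmem : a ∈ (Module.annihilator A (Ext (ModuleCat.of A (A ⧸ I)) M i)).jacobson :=
      IsLocalRing.maximalIdeal_le_jacobson _ ham
    refine Submodule.top_ne_pointwise_smul_of_mem_jacobson_annihilator hmem
      (eq_comm.1 (eq_top_iff.2 fun e _ ↦ ?_))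
    obtain ⟨e₂, rfl⟩ := Ext.contravariant_sequence_exact₁ hS M e (add_comm 1 i)
      ((ih _ hlt (i + 1) (by omega)).elim _ _)
    have hf : (colonShortComplex a hcol rfl).f = a • 𝟙 (ModuleCat.of A (A ⧸ I)) := by
      ext x
      rfl
    have hsmul : ∀ e : Ext (ModuleCat.of A (A ⧸ I)) M i,
        (Ext.mk₀ (a • 𝟙 (ModuleCat.of A (A ⧸ I)))).comp e (zero_add i) = a • e := fun e ↦ by
      simp [Ext.mk₀_smul]
    have he := (congrArg (fun φ ↦ (Ext.mk₀ φ).comp e₂ (zero_add i)) hf).trans (hsmul e₂)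
    exact (Submodule.mem_smul_pointwise_iff_exists _ _ _).2 ⟨e₂, trivial, he.symm⟩
  · refine subsingleton_ext_of_shortExact (colonShortComplex_shortExact a rfl rfl)
      (ih _ (lt_of_le_of_ne (fun b hb ↦ ?_) (Ne.symm hcol)) i hi) (ih _ hlt i hi)
    rw [Submodule.mem_colon_singleton]
    exact Ideal.mul_mem_right _ _ hb

/-- If `q` is generated by a regular sequence and `A / q` has length two, then `A` has finite
injective dimension over itself. The socle of `A / q` is its maximal ideal `(w)`, so every map
from the socle to `A / q` extends to `A / q`; this gives `Extᵈ⁺¹(k, A) = 0`, and the sequence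
`0 → k → A / q → k → 0` propagates the vanishing to higher degrees. -/
theorem hasInjectiveDimensionLE_of_length_two {rs : List A} (hreg : IsRegular A rs) {w : A}
    (hm : maximalIdeal A = ofList rs ⊔ Ideal.span {w}) (hw : ∀ a ∈ maximalIdeal A,
      a * w ∈ ofList rs) (hwq : w ∉ ofList rs) :
    HasInjectiveDimensionLE (ModuleCat.of A A) rs.length := by
  have hcol : (ofList rs).colon {w} = maximalIdeal A := by
    refine le_antisymm (le_maximalIdeal fun h ↦ hwq ?_) fun b hb ↦ ?_
    · have : (1 : A) ∈ (ofList rs).colon {w} := h ▸ trivial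
      rwa [Submodule.mem_colon_singleton, one_smul] at this
    · rw [Submodule.mem_colon_singleton]
      exact hw b hb
  have hann : ∀ I : Ideal A, ofList rs ≤ I → ∀ r ∈ rs, r ∈ Module.annihilator A (A ⧸ I) :=
    fun I hI r hr ↦ by rw [Ideal.annihilator_quotient]; exact hI (Ideal.subset_span hr)
  have hS := colonShortComplex_shortExact w hcol hm.symm
  have hsurj := (surjective_mk₀_comp_iff_of_isRegular rs (ModuleCat.of A A) hreg
    (N' := ModuleCat.of A (A ⧸ maximalIdeal A)) (N := ModuleCat.of A (A ⧸ ofList rs))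
    (colonShortComplex w hcol hm.symm).f (hann _ (hm ▸ le_sup_left)) (hann _ le_rfl)).2 (by
      intro φ
      obtain ⟨v, hv⟩ := Submodule.mkQ_surjective _ (φ.hom (Submodule.Quotient.mk 1))
      have hvm : ∀ a ∈ maximalIdeal A, a * v ∈ ofList rs := by
        intro a ha
        have h0 : φ.hom (a • (Submodule.Quotient.mk 1 : A ⧸ maximalIdeal A)) = 0 := by
          rw [← Submodule.Quotient.mk_smul,
            (Submodule.Quotient.mk_eq_zero _).2 (by simpa using ha)]
          exact map_zero φ.hom
        rw [map_smul, ← hv, ← map_smul] at h0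
        simpa using (Submodule.Quotient.mk_eq_zero _).1 h0
      have hvm' : v ∈ maximalIdeal A := by
        by_contra hcon
        have hu : IsUnit v := by simpa using hcon
        refine hwq ((Ideal.mul_unit_mem_iff_mem _ hu).1 (hvm w ?_))
        exact hm ▸ Ideal.mem_sup_right (Ideal.mem_span_singleton_self w)
      rw [hm] at hvm'
      obtain ⟨j, hj, c, hc, rfl⟩ := Submodule.mem_sup.1 hvm'
      obtain ⟨c, rfl⟩ := Ideal.mem_span_singleton'.1 hc
      refine ⟨ModuleCat.ofHom (Submodule.mapQ (ofList rs) (ofList rs • ⊤ : Submodule A A)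
        (LinearMap.lsmul A A c) fun b hb ↦ by simpa using Ideal.mul_mem_left _ c hb), ?_⟩
      ext
      refine Eq.trans ?_ hv
      refine (Submodule.Quotient.eq _).2 ?_
      have : c * (w * 1) - (j + c * w) = - j := by ring
      simp only [smul_eq_mul, Ideal.mul_top, LinearMap.lsmul_apply]
      rw [this]
      exact neg_mem hj)
  have step : ∀ i, rs.length < i →
      Subsingleton (Ext (ModuleCat.of A (A ⧸ maximalIdeal A)) (ModuleCat.of A A) i) := by
    intro i hi
    induction i, hi using Nat.le_induction with
    | base =>
      refine subsingleton_of_forall_eq 0 fun e ↦ ?_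
      obtain ⟨e₁, rfl⟩ := Ext.contravariant_sequence_exact₃ hS _ e
        ((subsingleton_ext_quotient_ofList hreg _ (Nat.lt_succ_self _)).elim _ _)
        (add_comm 1 rs.length)
      obtain ⟨e₂, rfl⟩ := hsurj e₁
      exact hS.extClass_comp_assoc e₂
    | succ i hi ih =>
      refine subsingleton_of_forall_eq 0 fun e ↦ ?_
      obtain ⟨e₁, rfl⟩ := Ext.contravariant_sequence_exact₃ hS _ e
        ((subsingleton_ext_quotient_ofList hreg _ (by omega)).elim _ _) (add_comm 1 i)
      have h0 : e₁ = 0 := ih.elim _ _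
      rw [h0, Ext.comp_zero]
      rfl
  exact hasInjectiveDimensionLE_of_subsingleton_ext_residueField step

end Ext

/-! ### Kernels of surjections between regular local rings -/

section Kernel

variable {R T : Type*} [CommRing R] [CommRing T]

/-- Exchange: an element of `(l)` outside `𝔪 (l)` replaces one of the generators. -/
theorem mem_maximalIdeal_mul_or_exists_ofList_cons_eq [IsLocalRing R] (l : List R) :
    ∀ x ∈ ofList l, x ∈ maximalIdeal R * ofList l ∨
      ∃ l' : List R, l'.length + 1 = l.length ∧ ofList l = ofList (x :: l') := by
  induction l with
  | nil =>
    intro x hx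
    rw [ofList_nil, Ideal.mem_bot] at hx
    exact .inl (hx ▸ zero_mem _)
  | cons a l ih =>
    intro x hx
    rw [ofList_cons] at hx
    obtain ⟨b, hb, y, hy, rfl⟩ := Submodule.mem_sup.1 hx
    obtain ⟨c, rfl⟩ := Ideal.mem_span_singleton'.1 hb
    by_cases hc : IsUnit c
    · refine .inr ⟨l, rfl, ?_⟩
      rw [ofList_cons, ofList_cons]
      refine le_antisymm (sup_le ?_ le_sup_right) (sup_le ?_ le_sup_right)
      · rw [Ideal.span_singleton_le_iff_mem, ← Ideal.unit_mul_mem_iff_mem _ hc]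
        have h1 : c * a + y ∈ Ideal.span {c * a + y} ⊔ ofList l :=
          Ideal.mem_sup_left (Ideal.mem_span_singleton_self _)
        exact (Ideal.add_mem_iff_left _ (Ideal.mem_sup_right hy)).1 h1
      · rwa [Ideal.span_singleton_le_iff_mem]
    · have hcm : c ∈ maximalIdeal R := hc
      have hle : ofList l ≤ ofList (a :: l) := ofList_cons a l ▸ le_sup_right
      have ha : a ∈ ofList (a :: l) := Ideal.subset_span (by simp)
      rcases ih y hy with h | ⟨l', hlen, hl'⟩
      · exact .inl (add_mem (Ideal.mul_mem_mul hcm ha) (Ideal.mul_mono_right hle h))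
      · refine .inr ⟨a :: l', by simp [hlen], ?_⟩
        rw [ofList_cons, hl', ofList_cons, ofList_cons, ofList_cons]
        refine le_antisymm (sup_le ?_ (sup_le ?_ ?_)) (sup_le ?_ (sup_le ?_ ?_))
        · exact le_sup_left.trans le_sup_right
        · rw [Ideal.span_singleton_le_iff_mem]
          have h1 : c * a + y ∈ Ideal.span {c * a + y} ⊔ (Ideal.span {a} ⊔ ofList l') :=
            Ideal.mem_sup_left (Ideal.mem_span_singleton_self _)
          exact (Ideal.add_mem_iff_right _ (Ideal.mem_sup_right (Ideal.mem_sup_left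
            (Ideal.mul_mem_left _ c (Ideal.mem_span_singleton_self a))))).1 h1
        · exact le_sup_right.trans le_sup_right
        · rw [Ideal.span_singleton_le_iff_mem]
          exact add_mem (Ideal.mem_sup_left (Ideal.mul_mem_left _ c
            (Ideal.mem_span_singleton_self a)))
            (Ideal.mem_sup_right (Ideal.mem_sup_left (Ideal.mem_span_singleton_self y)))
        · exact le_sup_left
        · exact le_sup_right.trans le_sup_right

theorem maximalIdeal_eq_ker_sup_ofList [IsLocalRing R] [IsLocalRing T] {f : R →+* T}
    (hf : Function.Surjective f) {as : List R} (has : ofList (as.map f) = maximalIdeal T) :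
    maximalIdeal R = RingHom.ker f ⊔ ofList as := by
  rw [← map_ofList] at has
  have hm := map_maximalIdeal_of_surjective f hf
  have hker : RingHom.ker f ≤ maximalIdeal R := le_maximalIdeal (RingHom.ker_ne_top f)
  have h1 := Ideal.comap_map_of_surjective' f hf (ofList as)
  have h2 := Ideal.comap_map_of_surjective' f hf (maximalIdeal R)
  rw [has, ← hm, h2, sup_eq_left.2 hker] at h1
  rw [h1, sup_comm]

/-- The kernel contains a minimal generator `x` of `𝔪`; then `R / x` is a regular local ring, hence
a domain, of the same dimension as `T`, so it has no room for a further kernel. -/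
theorem IsRegularLocalRing.exists_ker_eq_span_singleton [IsRegularLocalRing R]
    [IsRegularLocalRing T] {n : ℕ} (hR : ringKrullDim R = (n + 1 : ℕ)) (hT : ringKrullDim T = n)
    {f : R →+* T} (hf : Function.Surjective f) : ∃ x, RingHom.ker f = Ideal.span {x} := by
  have hker : RingHom.ker f ≤ maximalIdeal R := le_maximalIdeal (RingHom.ker_ne_top f)
  obtain ⟨ts, hts, htlen⟩ := IsRegularLocalRing.exists_ofList_eq_maximalIdeal T
  obtain ⟨as, rfl⟩ := (List.map_surjective_iff.2 hf) ts
  have hm := maximalIdeal_eq_ker_sup_ofList hf hts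
  have hnot : ¬ RingHom.ker f ≤ maximalIdeal R ^ 2 := by
    intro hle
    have h : maximalIdeal R = ofList as := by
      refine le_antisymm (Submodule.le_of_le_smul_of_le_jacobson_bot
        (maximalIdeal R).fg_of_isNoetherianRing (I := maximalIdeal R)
        (by rw [IsLocalRing.jacobson_eq_maximalIdeal _ bot_ne_top]) ?_) (hm ▸ le_sup_right)
      rw [smul_eq_mul, ← sq]
      exact hm.le.trans (sup_le (hle.trans le_sup_right) le_sup_left)
    have h1 := ringKrullDim_le_length_of_maximalIdeal_le h
    rw [List.length_map, hT] at htlen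
    rw [htlen, hR] at h1
    exact absurd (by exact_mod_cast h1 : n + 1 ≤ n) (by omega)
  obtain ⟨x, hxker, hx2⟩ := SetLike.not_le_iff_exists.1 hnot
  obtain ⟨l, hl, hllen⟩ := IsRegularLocalRing.exists_ofList_eq_maximalIdeal R
  rcases mem_maximalIdeal_mul_or_exists_ofList_cons_eq l x (hl ▸ hker hxker) with h | ⟨l', hlen, hl'⟩
  · rw [hl, ← sq] at h
    exact absurd h hx2
  have hgen : maximalIdeal R = ofList ([x] ++ l') := hl.symm.trans hl'
  obtain ⟨hreg, hdim⟩ := IsRegularLocalRing.quotient_ofList (l₁ := [x]) (l₂ := l') hgen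
    (by rw [← hllen, ← hlen]; simp)
  have hle : ofList [x] ≤ RingHom.ker f := by
    rw [ofList_singleton, Ideal.span_singleton_le_iff_mem]; exact hxker
  refine ⟨x, le_antisymm (fun r hr ↦ ?_) (ofList_singleton x ▸ hle)⟩
  by_contra hrx
  have h1 := ringKrullDim_succ_le_of_surjective (Ideal.Quotient.lift (ofList [x]) f hle)
    (Ideal.Quotient.lift_surjective_of_surjective _ _ hf) (r := Ideal.Quotient.mk _ r)
    (mem_nonZeroDivisors_of_ne_zero
      (by rwa [Ne, Ideal.Quotient.eq_zero_iff_mem, ofList_singleton]))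
    hr
  have hln : l'.length = n := by
    rw [hR, ← hlen] at hllen
    exact Nat.succ_injective (by exact_mod_cast hllen)
  rw [hT, hdim, hln] at h1
  exact absurd (by exact_mod_cast h1 : n + 1 ≤ n) (by omega)

end Kernel

/-! ### Fiber products of rings -/

section FiberProduct

open scoped Pointwise

theorem QuotSMulTop.mk_eq_zero_iff {A L : Type*} [CommRing A] [AddCommGroup L] [Module A L]
    {x : A} {l : L} : (Submodule.Quotient.mk l : QuotSMulTop x L) = 0 ↔ ∃ l', x • l' = l := by
  rw [Submodule.Quotient.mk_eq_zero, Submodule.mem_smul_pointwise_iff_exists]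
  simp

theorem QuotSMulTop.mk_eq_mk_iff {A L : Type*} [CommRing A] [AddCommGroup L] [Module A L]
    {x : A} {l l' : L} :
    (Submodule.Quotient.mk l : QuotSMulTop x L) = Submodule.Quotient.mk l' ↔
      ∃ c, x • c = l - l' := by
  rw [← sub_eq_zero, ← Submodule.Quotient.mk_sub, QuotSMulTop.mk_eq_zero_iff]

/-- Regular sequences pass to a fiber product `M = N₁ ×_P N₂` of modules. On `P` the last term `z`
need not be regular, since `M / rs M` embeds in the product of the `Nᵢ / rs Nᵢ`. -/
theorem isWeaklyRegular_append_of_fiberProduct {A : Type*} [CommRing A] (z : A) (rs : List A) :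
    ∀ {M N₁ N₂ P : Type*} [AddCommGroup M] [Module A M] [AddCommGroup N₁] [Module A N₁]
      [AddCommGroup N₂] [Module A N₂] [AddCommGroup P] [Module A P]
      (i₁ : M →ₗ[A] N₁) (i₂ : M →ₗ[A] N₂) (p₁ : N₁ →ₗ[A] P) (p₂ : N₂ →ₗ[A] P),
      (∀ m, i₁ m = 0 → i₂ m = 0 → m = 0) → (∀ m, p₁ (i₁ m) = p₂ (i₂ m)) →
      (∀ a b, p₁ a = p₂ b → ∃ m, i₁ m = a ∧ i₂ m = b) → Function.Surjective p₁ →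
      IsWeaklyRegular N₁ (rs ++ [z]) → IsWeaklyRegular N₂ (rs ++ [z]) → IsWeaklyRegular P rs →
      IsWeaklyRegular M (rs ++ [z]) := by
  induction rs with
  | nil =>
    intro M N₁ N₂ P _ _ _ _ _ _ _ _ i₁ i₂ p₁ p₂ hinj _ _ _ h₁ h₂ _
    rw [List.nil_append, isWeaklyRegular_singleton_iff] at *
    refine .of_right_eq_zero_of_smul fun m hm ↦ hinj m ?_ ?_
    · exact h₁.right_eq_zero_of_smul (by rw [← map_smul, hm, map_zero])
    · exact h₂.right_eq_zero_of_smul (by rw [← map_smul, hm, map_zero])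
  | cons x rs ih =>
    intro M N₁ N₂ P _ _ _ _ _ _ _ _ i₁ i₂ p₁ p₂ hinj hcomm hlift hsurj h₁ h₂ hP
    rw [List.cons_append, isWeaklyRegular_cons_iff] at *
    obtain ⟨hx₁, h₁⟩ := h₁
    obtain ⟨hx₂, h₂⟩ := h₂
    obtain ⟨hxP, hP⟩ := hP
    refine ⟨.of_right_eq_zero_of_smul fun m hm ↦ hinj m ?_ ?_, ?_⟩
    · exact hx₁.right_eq_zero_of_smul (by rw [← map_smul, hm, map_zero])
    · exact hx₂.right_eq_zero_of_smul (by rw [← map_smul, hm, map_zero])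
    refine ih (QuotSMulTop.map x i₁) (QuotSMulTop.map x i₂) (QuotSMulTop.map x p₁)
      (QuotSMulTop.map x p₂) ?_ ?_ ?_ (QuotSMulTop.map_surjective x hsurj) h₁ h₂ hP
    · intro m
      obtain ⟨m, rfl⟩ := Submodule.Quotient.mk_surjective _ m
      rw [QuotSMulTop.map_apply_mk, QuotSMulTop.map_apply_mk, QuotSMulTop.mk_eq_zero_iff,
        QuotSMulTop.mk_eq_zero_iff, QuotSMulTop.mk_eq_zero_iff]
      rintro ⟨a, ha⟩ ⟨b, hb⟩
      have hab : p₁ a = p₂ b := hxP (by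
        change x • p₁ a = x • p₂ b
        rw [← map_smul, ← map_smul, ha, hb, hcomm])
      obtain ⟨m', rfl, rfl⟩ := hlift a b hab
      refine ⟨m', sub_eq_zero.1 (hinj _ ?_ ?_)⟩
      · rw [map_sub, map_smul, ha, sub_self]
      · rw [map_sub, map_smul, hb, sub_self]
    · intro m
      obtain ⟨m, rfl⟩ := Submodule.Quotient.mk_surjective _ m
      simp only [QuotSMulTop.map_apply_mk, hcomm]
    · intro a b
      obtain ⟨a, rfl⟩ := Submodule.Quotient.mk_surjective _ a
      obtain ⟨b, rfl⟩ := Submodule.Quotient.mk_surjective _ b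
      rw [QuotSMulTop.map_apply_mk, QuotSMulTop.map_apply_mk, QuotSMulTop.mk_eq_mk_iff]
      rintro ⟨c, hc⟩
      obtain ⟨a', rfl⟩ := hsurj c
      obtain ⟨m, hm₁, rfl⟩ := hlift (a - x • a') b (by rw [map_sub, map_smul, hc]; abel)
      refine ⟨Submodule.Quotient.mk m, ?_, rfl⟩
      rw [QuotSMulTop.map_apply_mk, QuotSMulTop.mk_eq_mk_iff, hm₁]
      exact ⟨-a', by rw [smul_neg]; abel⟩

end FiberProduct

section FiberProductRing

variable {A R S T : Type*} [CommRing A] [CommRing R] [CommRing S] [CommRing T]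

/-- `A`, with the projections `π₁ : A → R` and `π₂ : A → S`, is a fiber product of `f : R → T` and
`g : S → T`. The formulation by elements makes the symmetry in `R` and `S` usable. -/
structure RingHom.IsFiberProduct (π₁ : A →+* R) (π₂ : A →+* S) (f : R →+* T) (g : S →+* T) :
    Prop where
  comm : ∀ a, f (π₁ a) = g (π₂ a)
  eq_zero : ∀ a, π₁ a = 0 → π₂ a = 0 → a = 0
  exists_lift : ∀ r s, f r = g s → ∃ a, π₁ a = r ∧ π₂ a = s

theorem fiberProduct.isFiberProduct (f : R →+* T) (g : S →+* T) :
    RingHom.IsFiberProduct ((RingHom.fst R S).comp (fiberProduct f g).subtype)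
      ((RingHom.snd R S).comp (fiberProduct f g).subtype) f g where
  comm a := mem_fiberProduct.1 a.2
  eq_zero _ h₁ h₂ := Subtype.ext (Prod.ext h₁ h₂)
  exists_lift r s h := ⟨⟨(r, s), mem_fiberProduct.2 h⟩, rfl, rfl⟩

/-- Over a surjection `A → B`, a submodule over `A` is one over `B`. -/
theorem isNoetherian_of_algebraMap_surjective (A B M : Type*) [CommRing A] [CommRing B]
    [Algebra A B] [AddCommGroup M] [Module A M] [Module B M] [IsScalarTower A B M]
    (hs : Function.Surjective (algebraMap A B)) [IsNoetherian B M] : IsNoetherian A M := by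
  refine ⟨fun N ↦ ?_⟩
  let N' : Submodule B M :=
    { N.toAddSubmonoid with
      smul_mem' := fun b m hm ↦ by
        obtain ⟨a, rfl⟩ := hs b
        rw [algebraMap_smul]
        exact N.smul_mem a hm }
  have h : (N'.restrictScalars A).FG :=
    Submodule.FG.restrictScalars_of_surjective (IsNoetherian.noetherian N') hs
  exact h

theorem eq_maximalIdeal_of_ker_le [IsLocalRing A] [IsLocalRing R] {π : A →+* R}
    (hπ : Function.Surjective π) {I Q : Ideal A}
    (hR : ∀ Q : Ideal R, Q.IsPrime → I.map π ≤ Q → Q = maximalIdeal R) (hQ : Q.IsPrime)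
    (hIQ : I ≤ Q) (hk : RingHom.ker π ≤ Q) : Q = maximalIdeal A := by
  have hmap := hR _ (Ideal.map_isPrime_of_surjective hπ hk) (Ideal.map_mono hIQ)
  have := Function.Surjective.isLocalHom π hπ
  rw [← sup_eq_left.2 hk, ← Ideal.comap_map_of_surjective' π hπ Q, hmap,
    IsLocalRing.maximalIdeal_comap]

/-- The primes containing a regular sequence of length `dim R` are maximal. -/
theorem eq_maximalIdeal_of_ofList_le [IsLocalRing R] [IsNoetherianRing R] {l : List R}
    (hl : IsRegular R l) (hdim : (l.length : WithBot ℕ∞) = ringKrullDim R) {Q : Ideal R}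
    (hQ : Q.IsPrime) (hlQ : ofList l ≤ Q) : Q = maximalIdeal R := by
  have h := ringKrullDim_add_length_eq_ringKrullDim_of_isRegular l hl
  have h0 : ringKrullDim (R ⧸ ofList l) ≤ (0 : ℕ) := by
    rw [← ENat.WithBot.add_le_add_natCast_right_iff (c := l.length), h, ← hdim]
    simp
  have : Ring.KrullDimLE 0 (R ⧸ ofList l) := Ring.krullDimLE_iff.2 h0
  have hker : RingHom.ker (Ideal.Quotient.mk (ofList l)) ≤ Q := by rwa [Ideal.mk_ker]
  have hmap := Ideal.map_isPrime_of_surjective Ideal.Quotient.mk_surjective hker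
  have hmax := Ideal.comap_isMaximal_of_surjective _ Ideal.Quotient.mk_surjective
    (K := Q.map (Ideal.Quotient.mk (ofList l)))
  rw [Ideal.comap_map_of_surjective' _ Ideal.Quotient.mk_surjective, sup_eq_left.2 hker] at hmax
  exact IsLocalRing.eq_maximalIdeal hmax

namespace RingHom.IsFiberProduct

variable {π₁ : A →+* R} {π₂ : A →+* S} {f : R →+* T} {g : S →+* T}

theorem symm (h : IsFiberProduct π₁ π₂ f g) : IsFiberProduct π₂ π₁ g f where
  comm a := (h.comm a).symm
  eq_zero a h₁ h₂ := h.eq_zero a h₂ h₁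
  exists_lift s r hsr := let ⟨a, h₁, h₂⟩ := h.exists_lift r s hsr.symm; ⟨a, h₂, h₁⟩

theorem eq_of_map_eq (h : IsFiberProduct π₁ π₂ f g) {a b : A} (h₁ : π₁ a = π₁ b)
    (h₂ : π₂ a = π₂ b) : a = b :=
  sub_eq_zero.1 (h.eq_zero _ (by rw [map_sub, h₁, sub_self]) (by rw [map_sub, h₂, sub_self]))

theorem surjective_fst (h : IsFiberProduct π₁ π₂ f g) (hg : Function.Surjective g) :
    Function.Surjective π₁ := fun r ↦
  let ⟨s, hs⟩ := hg (f r)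
  let ⟨a, ha, _⟩ := h.exists_lift r s hs.symm
  ⟨a, ha⟩

theorem exists_list_lift (h : IsFiberProduct π₁ π₂ f g) :
    ∀ {rs : List R} {ss : List S}, rs.map f = ss.map g →
      ∃ us : List A, us.map π₁ = rs ∧ us.map π₂ = ss
  | [], [], _ => ⟨[], rfl, rfl⟩
  | r :: rs, s :: ss, hrs => by
    rw [List.map_cons, List.map_cons, List.cons.injEq] at hrs
    obtain ⟨u, rfl, rfl⟩ := h.exists_lift r s hrs.1
    obtain ⟨us, rfl, rfl⟩ := h.exists_list_lift hrs.2
    exact ⟨u :: us, rfl, rfl⟩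

theorem isLocalRing [IsLocalRing R] [IsLocalRing S] [IsLocalRing T]
    (h : IsFiberProduct π₁ π₂ f g) (hf : Function.Surjective f) (hg : Function.Surjective g) :
    IsLocalRing A := by
  have := Function.Surjective.isLocalHom f hf
  have := Function.Surjective.isLocalHom g hg
  have : IsLocalHom π₁ := by
    refine ⟨fun a ha ↦ ?_⟩
    have ha₂ : IsUnit (π₂ a) := by
      refine isUnit_of_map_unit g _ ?_
      rw [← h.comm]
      exact ha.map f
    obtain ⟨r, hr⟩ := ha.exists_right_inv
    obtain ⟨s, hs⟩ := ha₂.exists_right_inv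
    have hrs : f r = g s := by
      refine (ha.map f).mul_left_cancel ?_
      rw [← map_mul, hr, h.comm, ← map_mul, hs, map_one, map_one]
    obtain ⟨b, rfl, rfl⟩ := h.exists_lift r s hrs
    exact IsUnit.of_mul_eq_one b (h.eq_of_map_eq (by simpa using hr) (by simpa using hs))
  exact RingHom.domain_isLocalRing π₁

theorem isNoetherianRing [IsNoetherianRing R] [IsNoetherianRing S]
    (h : IsFiberProduct π₁ π₂ f g) (hf : Function.Surjective f) (hg : Function.Surjective g) :
    IsNoetherianRing A := by
  let := π₁.toAlgebra
  let := π₂.toAlgebra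
  have := isNoetherian_of_algebraMap_surjective A R R (h.surjective_fst hg)
  have := isNoetherian_of_algebraMap_surjective A S S (h.symm.surjective_fst hf)
  refine isNoetherian_of_injective ((Algebra.linearMap A R).prod (Algebra.linearMap A S))
    fun a b hab ↦ ?_
  exact h.eq_of_map_eq (Prod.ext_iff.1 hab).1 (Prod.ext_iff.1 hab).2

theorem isWeaklyRegular_append_singleton (h : IsFiberProduct π₁ π₂ f g)
    (hf : Function.Surjective f) {us : List A} {z : A}
    (h₁ : IsWeaklyRegular R ((us ++ [z]).map π₁)) (h₂ : IsWeaklyRegular S ((us ++ [z]).map π₂))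
    (hT : IsWeaklyRegular T (us.map (f.comp π₁))) : IsWeaklyRegular A (us ++ [z]) := by
  let := π₁.toAlgebra
  let := π₂.toAlgebra
  let := (f.comp π₁).toAlgebra
  refine isWeaklyRegular_append_of_fiberProduct z us (Algebra.linearMap A R)
    (Algebra.linearMap A S) (P := T) ⟨⟨f, map_add f⟩, fun a r ↦ ?_⟩ ⟨⟨g, map_add g⟩, fun a s ↦ ?_⟩
    h.eq_zero h.comm h.exists_lift hf ((isWeaklyRegular_map_algebraMap_iff R R _).1 h₁)
    ((isWeaklyRegular_map_algebraMap_iff S S _).1 h₂)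
    ((isWeaklyRegular_map_algebraMap_iff T T _).1 hT)
  · change f (π₁ a * r) = f (π₁ a) * f r
    exact map_mul f _ _
  · change g (π₂ a * s) = f (π₁ a) * g s
    rw [map_mul, h.comm]

theorem map_mem_maximalIdeal_iff [IsLocalRing A] [IsLocalRing R] (hπ : Function.Surjective π₁)
    {a : A} : π₁ a ∈ maximalIdeal R ↔ a ∈ maximalIdeal A := by
  have := Function.Surjective.isLocalHom π₁ hπ
  simp only [mem_maximalIdeal, mem_nonunits_iff, isUnit_map_iff]

/-- The two projections have kernels with zero product, so a prime of `A` comes from `R` or `S`. -/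
theorem eq_maximalIdeal_of_isPrime [IsLocalRing A] [IsLocalRing R] [IsLocalRing S]
    (h : IsFiberProduct π₁ π₂ f g) (h₁ : Function.Surjective π₁) (h₂ : Function.Surjective π₂)
    {I : Ideal A} (hR : ∀ Q : Ideal R, Q.IsPrime → I.map π₁ ≤ Q → Q = maximalIdeal R)
    (hS : ∀ Q : Ideal S, Q.IsPrime → I.map π₂ ≤ Q → Q = maximalIdeal S) {Q : Ideal A}
    (hQ : Q.IsPrime) (hIQ : I ≤ Q) : Q = maximalIdeal A := by
  have hker : RingHom.ker π₁ * RingHom.ker π₂ ≤ Q := by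
    refine Ideal.mul_le.2 fun a ha b hb ↦ ?_
    rw [RingHom.mem_ker] at ha hb
    rw [h.eq_zero (a * b) (by rw [map_mul, ha, zero_mul]) (by rw [map_mul, hb, mul_zero])]
    exact zero_mem Q
  rcases hQ.mul_le.1 hker with hk | hk
  · exact eq_maximalIdeal_of_ker_le h₁ hR hQ hIQ hk
  · exact eq_maximalIdeal_of_ker_le h₂ hS hQ hIQ hk

/-- Modulo `(us)` the element `w` spans a copy of the residue field of `A` modulo `z`: for
`a ∈ 𝔪` write `π₁ a = p + π₁ ρ` with `p ∈ ker f` and `ρ ∈ (us)`; then `a w = (p, 0) z + ρ w`. -/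
theorem mul_mem_ofList_append [IsLocalRing A] [IsLocalRing R] (h : IsFiberProduct π₁ π₂ f g)
    (hg : Function.Surjective g) {us : List A} {z w : A} (hw₁ : π₁ w = π₁ z) (hw₂ : π₂ w = 0)
    (hm : maximalIdeal R ≤ RingHom.ker f ⊔ ofList (us.map π₁)) {a : A}
    (ha : a ∈ maximalIdeal A) : a * w ∈ ofList (us ++ [z]) := by
  have hπ := h.surjective_fst hg
  obtain ⟨p, hp, r, hr, hpr⟩ := Submodule.mem_sup.1 (hm ((map_mem_maximalIdeal_iff hπ).2 ha))
  rw [← map_ofList] at hr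
  obtain ⟨ρ, hρ, rfl⟩ := (Ideal.mem_map_iff_of_surjective π₁ hπ).1 hr
  obtain ⟨p', rfl, hp'⟩ := h.exists_lift p 0 (by rw [map_zero, (RingHom.mem_ker).1 hp])
  have hsum : a * w = ρ * w + p' * z := by
    refine h.eq_of_map_eq ?_ ?_
    · simp only [map_mul, map_add, hw₁, ← hpr]
      ring
    · simp only [map_mul, map_add, hw₂, hp']
      ring
  rw [hsum, ofList_append, ofList_singleton]
  exact Submodule.add_mem_sup (Ideal.mul_mem_right _ _ hρ)
    (Ideal.mul_mem_left _ _ (Ideal.mem_span_singleton_self z))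

/-- Under the colon condition `hG`, which holds when `A` is Gorenstein, the element `w = (π₁ z, 0)`
of the socle of `A / (us, z)` lies in every nonzero ideal of that ring. Applied to `(ν, 0)` with
`ν ∈ ker f`, this puts `ν` into `(us, π₁ z)`, since `π₁ z` is a minimal generator of `𝔪`. -/
theorem maximalIdeal_eq_ofList [IsLocalRing A] [IsLocalRing R] [IsLocalRing S]
    [Nontrivial T] (h : IsFiberProduct π₁ π₂ f g) (hf : Function.Surjective f)
    (hg : Function.Surjective g) {us : List A} {z : A} (hus : ∀ u ∈ us, u ∈ maximalIdeal A)
    (hz : f (π₁ z) = 0) (hm : maximalIdeal R ≤ RingHom.ker f ⊔ ofList (us.map π₁))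
    (hx : π₁ z ∉ ofList (us.map π₁) ⊔ maximalIdeal R ^ 2)
    (hy : ∀ e, π₂ z * e ∈ ofList (us.map π₂) → e ∈ ofList (us.map π₂))
    (hG : ∀ v w, (∀ a, a * v ∈ ofList (us ++ [z]) → a * w ∈ ofList (us ++ [z])) →
      w ∈ ofList (us ++ [z]) ⊔ Ideal.span {v}) :
    maximalIdeal R = ofList (us.map π₁ ++ [π₁ z]) := by
  have hπ₁ := h.surjective_fst hg
  have hπ₂ := h.symm.surjective_fst hf
  have hkerm : RingHom.ker f ≤ maximalIdeal R := le_maximalIdeal (RingHom.ker_ne_top f)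
  have husA : ofList us ≤ maximalIdeal A := Ideal.span_le.2 hus
  have hmap : ∀ {ρ}, ρ ∈ ofList us → π₁ ρ ∈ ofList (us.map π₁) := fun hρ ↦
    map_ofList π₁ us ▸ Ideal.mem_map_of_mem π₁ hρ
  have hmap₂ : ∀ {ρ}, ρ ∈ ofList us → π₂ ρ ∈ ofList (us.map π₂) := fun hρ ↦
    map_ofList π₂ us ▸ Ideal.mem_map_of_mem π₂ hρ
  rw [ofList_append, ofList_singleton]
  refine le_antisymm (hm.trans (sup_le (fun ν hν ↦ ?_) le_sup_left)) (sup_le ?_ ?_)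
  · obtain ⟨v, rfl, hv₂⟩ := h.exists_lift ν 0 (by rw [map_zero, (RingHom.mem_ker).1 hν])
    obtain ⟨w, hw₁, hw₂⟩ := h.exists_lift (π₁ z) 0 (by rw [map_zero, hz])
    by_cases hvq : v ∈ ofList (us ++ [z])
    · have h1 := Ideal.mem_map_of_mem π₁ hvq
      rwa [map_ofList, List.map_append, List.map_singleton, ofList_append,
        ofList_singleton] at h1
    have hw := hG v w fun a ha ↦ h.mul_mem_ofList_append hg hw₁ hw₂ hm <|
      (mem_maximalIdeal a).2 fun hu ↦ hvq ((Ideal.unit_mul_mem_iff_mem _ hu).1 ha)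
    rw [ofList_append, ofList_singleton] at hw
    obtain ⟨q, hq, b', hb', hqb⟩ := Submodule.mem_sup.1 hw
    obtain ⟨ρ, hρ, c', hc', rfl⟩ := Submodule.mem_sup.1 hq
    obtain ⟨b, rfl⟩ := Ideal.mem_span_singleton'.1 hb'
    obtain ⟨c, rfl⟩ := Ideal.mem_span_singleton'.1 hc'
    have hcm : c ∈ maximalIdeal A := by
      have h2 : π₂ z * π₂ c = -π₂ ρ := by
        have h3 := congrArg π₂ hqb
        rw [hw₂, map_add, map_add, map_mul, map_mul, hv₂, mul_zero, add_zero] at h3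
        linear_combination h3
      have h4 := hy _ (h2 ▸ neg_mem (hmap₂ hρ))
      rw [← map_ofList] at h4
      obtain ⟨c₀, hc₀, hc₀c⟩ := (Ideal.mem_map_iff_of_surjective π₂ hπ₂).1 h4
      rw [← map_mem_maximalIdeal_iff hπ₂, ← hc₀c, map_mem_maximalIdeal_iff hπ₂]
      exact husA hc₀
    have h1 : (1 - π₁ c) * π₁ z = π₁ ρ + π₁ b * π₁ v := by
      have h3 := congrArg π₁ hqb
      rw [hw₁, map_add, map_add, map_mul, map_mul] at h3
      linear_combination -h3
    by_cases hb : IsUnit (π₁ b)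
    · rw [← Ideal.unit_mul_mem_iff_mem _ hb, ← add_sub_cancel_left (π₁ ρ) (π₁ b * π₁ v), ← h1]
      exact sub_mem (Ideal.mem_sup_right (Ideal.mul_mem_left _ _ (Ideal.mem_span_singleton_self _)))
        (Ideal.mem_sup_left (hmap hρ))
    · refine absurd ?_ hx
      have hu : IsUnit (1 - π₁ c) := by
        by_contra hu
        have h2 := add_mem ((mem_maximalIdeal _).2 hu) ((map_mem_maximalIdeal_iff hπ₁).2 hcm)
        rw [sub_add_cancel] at h2
        exact (mem_maximalIdeal _).1 h2 isUnit_one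
      rw [← Ideal.unit_mul_mem_iff_mem _ hu, h1, sq]
      exact Submodule.add_mem_sup (hmap hρ)
        (Ideal.mul_mem_mul ((mem_maximalIdeal _).2 hb) (hkerm hν))
  · rw [← map_ofList, Ideal.map_le_iff_le_comap]
    exact fun a ha ↦ (map_mem_maximalIdeal_iff hπ₁).2 (husA ha)
  · exact (Ideal.span_singleton_le_iff_mem _).2 (hkerm hz)

end RingHom.IsFiberProduct

end FiberProductRing

/-! ### The Gorenstein property of the fiber product -/

section Implications

variable {A R S T : Type*} [CommRing A] [CommRing R] [CommRing S] [CommRing T]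

theorem RingTheory.Sequence.IsWeaklyRegular.mem_of_mul_mem {rs : List R} {x : R}
    (h : IsWeaklyRegular R (rs ++ [x])) {e : R} (he : x * e ∈ ofList rs) : e ∈ ofList rs := by
  rw [isWeaklyRegular_append_iff, isWeaklyRegular_singleton_iff,
    isSMulRegular_quotient_smul_top_iff] at h
  exact h.2 e he

/-- Generators of the maximal ideal of `T` lift to a regular sequence of the Cohen-Macaulay ring
`R`, which a minimal generator `x ∈ ker f` of the maximal ideal completes to a maximal one. -/
theorem IsCohenMacaulayLocalRing.exists_isWeaklyRegular_lift [IsCohenMacaulayLocalRing R]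
    [IsLocalRing T] {ts : List T} (hts : ofList ts = maximalIdeal T)
    (hR : ringKrullDim R = (ts.length + 1 : ℕ)) {f : R →+* T} (hf : Function.Surjective f) :
    ∃ (rs : List R) (x : R), rs.map f = ts ∧ f x = 0 ∧
      maximalIdeal R = RingHom.ker f ⊔ ofList rs ∧ x ∉ ofList rs ⊔ maximalIdeal R ^ 2 ∧
      IsWeaklyRegular R (rs ++ [x]) := by
  obtain ⟨as, rfl⟩ := (List.map_surjective_iff.2 hf) ts
  have hm := maximalIdeal_eq_ker_sup_ofList hf hts
  obtain ⟨l, hl, hlm, hreg⟩ := IsCohenMacaulayLocalRing.exists_isRegular hR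
  obtain ⟨rs, x, hrs, hm', hx, hx', hwr⟩ := exists_isWeaklyRegular_append_singleton
    (le_maximalIdeal (RingHom.ker_ne_top f)) (as := as)
    (fun a ha ↦ hm ▸ Ideal.mem_sup_right (Ideal.subset_span ha)) hm.le
    (by rw [hl, List.length_map]) hlm hreg
  refine ⟨rs, x, ?_, hx, hm', hx', hwr⟩
  clear hm' hx' hwr hts hm hR hl
  induction hrs with
  | nil => rfl
  | cons h _ ih =>
    rw [List.map_cons, List.map_cons, ih, sub_eq_zero.1 ((map_sub f _ _).symm.trans h)]

namespace RingHom.IsFiberProduct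

variable {π₁ : A →+* R} {π₂ : A →+* S} {f : R →+* T} {g : S →+* T}

theorem isRegular_append_singleton [IsLocalRing A] [IsNoetherianRing A] [IsLocalRing R]
    [IsRegularLocalRing T] (h : IsFiberProduct π₁ π₂ f g) (hf : Function.Surjective f)
    (hg : Function.Surjective g) {us : List A} {z : A} (hz : f (π₁ z) = 0)
    (hus : ofList (us.map (f.comp π₁)) = maximalIdeal T)
    (hdim : (us.length : WithBot ℕ∞) = ringKrullDim T)
    (h₁ : IsWeaklyRegular R ((us ++ [z]).map π₁)) (h₂ : IsWeaklyRegular S ((us ++ [z]).map π₂)) :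
    IsRegular A (us ++ [z]) := by
  have hπ : Function.Surjective (f.comp π₁) := hf.comp (h.surjective_fst hg)
  refine (IsLocalRing.isRegular_iff_isWeaklyRegular_of_subset_maximalIdeal fun a ha ↦ ?_).2
    (h.isWeaklyRegular_append_singleton hf h₁ h₂
      (IsRegularLocalRing.isWeaklyRegular hus.symm (by rw [List.length_map, hdim])))
  rw [← map_mem_maximalIdeal_iff hπ]
  rcases List.mem_append.1 ha with ha | ha
  · exact hus ▸ Ideal.subset_span (List.mem_map_of_mem ha)
  · rw [List.mem_singleton.1 ha, RingHom.comp_apply, hz]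
    exact zero_mem _

/-- If `A` has finite injective dimension over itself, parameters `us, z` of `A` whose images in `R` and `S`
are as in `IsCohenMacaulayLocalRing.exists_isWeaklyRegular_lift` generate both maximal ideals. -/
theorem isRegularLocalRing_of_hasInjectiveDimensionLE [IsLocalRing A] [IsNoetherianRing A]
    [IsCohenMacaulayLocalRing R] [IsCohenMacaulayLocalRing S] [IsRegularLocalRing T]
    (h : IsFiberProduct π₁ π₂ f g) (hf : Function.Surjective f) (hg : Function.Surjective g)
    {n : ℕ} (hR : ringKrullDim R = (n + 1 : ℕ)) (hS : ringKrullDim S = (n + 1 : ℕ))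
    (hT : ringKrullDim T = n) {k : ℕ} [HasInjectiveDimensionLE (ModuleCat.of A A) k] :
    IsRegularLocalRing R ∧ IsRegularLocalRing S := by
  have hπ₁ := h.surjective_fst hg
  have hπ₂ := h.symm.surjective_fst hf
  obtain ⟨ts, hts, htlen⟩ := IsRegularLocalRing.exists_ofList_eq_maximalIdeal T
  obtain rfl : ts.length = n := by
    rw [hT] at htlen
    exact_mod_cast htlen
  obtain ⟨rs, x, hrs, hx, hmR, hx', hwR⟩ :=
    IsCohenMacaulayLocalRing.exists_isWeaklyRegular_lift hts hR hf
  obtain ⟨ss, y, hss, hy, hmS, hy', hwS⟩ :=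
    IsCohenMacaulayLocalRing.exists_isWeaklyRegular_lift hts hS hg
  obtain ⟨us, rfl, rfl⟩ := h.exists_list_lift (hrs.trans hss.symm)
  obtain ⟨z, rfl, rfl⟩ := h.exists_lift x y (hx.trans hy.symm)
  rw [List.map_map] at hrs
  have hlen : us.length = ts.length := by rw [← hrs, List.length_map]
  have hreg : IsRegular A (us ++ [z]) := by
    refine h.isRegular_append_singleton hf hg hx (by rw [RingHom.coe_comp, hrs, hts])
      (by rw [hlen, htlen]) ?_ ?_
    · rwa [List.map_append, List.map_singleton]
    · rwa [List.map_append, List.map_singleton]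
  have husm : ∀ u ∈ us, u ∈ maximalIdeal A := fun u hu ↦ by
    rw [← map_mem_maximalIdeal_iff hπ₁, hmR]
    exact Ideal.mem_sup_right (Ideal.subset_span (List.mem_map_of_mem hu))
  have hzm : z ∈ maximalIdeal A := by
    rw [← map_mem_maximalIdeal_iff hπ₁, hmR]
    exact Ideal.mem_sup_left hx
  have hmem : ∀ u ∈ us ++ [z], u ∈ maximalIdeal A := fun u hu ↦ by
    rcases List.mem_append.1 hu with hu | hu
    · exact husm u hu
    · exact List.mem_singleton.1 hu ▸ hzm
  have hQ : ∀ Q : Ideal A, Q.IsPrime → ofList (us ++ [z]) ≤ Q → Q = maximalIdeal A := by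
    refine fun Q hQ hle ↦ h.eq_maximalIdeal_of_isPrime hπ₁ hπ₂ ?_ ?_ hQ hle
    · rw [map_ofList]
      refine fun Q hQ hle ↦ eq_maximalIdeal_of_ofList_le
        ((IsLocalRing.isRegular_iff_isWeaklyRegular_of_subset_maximalIdeal ?_).2
          (by rwa [List.map_append, List.map_singleton])) (by simp [hR, hlen]) hQ hle
      simpa only [List.forall_mem_map, map_mem_maximalIdeal_iff hπ₁] using hmem
    · rw [map_ofList]
      refine fun Q hQ hle ↦ eq_maximalIdeal_of_ofList_le
        ((IsLocalRing.isRegular_iff_isWeaklyRegular_of_subset_maximalIdeal ?_).2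
          (by rwa [List.map_append, List.map_singleton])) (by simp [hS, hlen]) hQ hle
      simpa only [List.forall_mem_map, map_mem_maximalIdeal_iff hπ₂] using hmem
  have hG : ∀ v w, (∀ a, a * v ∈ ofList (us ++ [z]) → a * w ∈ ofList (us ++ [z])) →
      w ∈ ofList (us ++ [z]) ⊔ Ideal.span {v} := fun v w ↦
    mem_sup_span_of_hasInjectiveDimensionLE (n := k) hreg hQ
  constructor
  · exact .of_maximalIdeal_eq_ofList (h.maximalIdeal_eq_ofList hf hg husm hx hmR.le hx'
      (fun _ ↦ hwS.mem_of_mul_mem) hG) (by simp [hR, hlen])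
  · exact .of_maximalIdeal_eq_ofList (h.symm.maximalIdeal_eq_ofList hg hf husm hy hmS.le hy'
      (fun _ ↦ hwR.mem_of_mul_mem) hG) (by simp [hS, hlen])

/-- If `R` and `S` are regular, then `ker f = (x)` and `ker g = (y)`, and `A` modulo the regular
sequence `us, (x, y)` has length two: its maximal ideal is generated by the class of `(x, 0)`. -/
theorem isGorensteinLocalRing [IsRegularLocalRing R] [IsRegularLocalRing S]
    [IsRegularLocalRing T] (h : IsFiberProduct π₁ π₂ f g) (hf : Function.Surjective f)
    (hg : Function.Surjective g) {n : ℕ} (hR : ringKrullDim R = (n + 1 : ℕ))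
    (hS : ringKrullDim S = (n + 1 : ℕ)) (hT : ringKrullDim T = n) : IsGorensteinLocalRing A := by
  have hπ₁ := h.surjective_fst hg
  have hπ₂ := h.symm.surjective_fst hf
  have := h.isLocalRing hf hg
  have := h.isNoetherianRing hf hg
  obtain ⟨ts, hts, htlen⟩ := IsRegularLocalRing.exists_ofList_eq_maximalIdeal T
  obtain rfl : ts.length = n := by
    rw [hT] at htlen
    exact_mod_cast htlen
  obtain ⟨us, rfl⟩ := (List.map_surjective_iff.2 (hf.comp hπ₁)) ts
  rw [List.length_map] at hR hS htlen
  have hmap : us.map (f ∘ π₁) = (us.map π₂).map g := by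
    rw [List.map_map]
    exact List.map_congr_left fun u _ ↦ h.comm u
  have hmR := maximalIdeal_eq_ker_sup_ofList hf (as := us.map π₁) (by rw [List.map_map, hts])
  have hmS := maximalIdeal_eq_ker_sup_ofList hg (as := us.map π₂) (by rw [← hmap, hts])
  obtain ⟨x, hx⟩ := IsRegularLocalRing.exists_ker_eq_span_singleton hR
    (hT.trans (by rw [List.length_map])) hf
  obtain ⟨y, hy⟩ := IsRegularLocalRing.exists_ker_eq_span_singleton hS
    (hT.trans (by rw [List.length_map])) hg
  have hfx : f x = 0 := (RingHom.mem_ker).1 (hx ▸ Ideal.mem_span_singleton_self x)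
  have hgy : g y = 0 := (RingHom.mem_ker).1 (hy ▸ Ideal.mem_span_singleton_self y)
  obtain ⟨z, rfl, rfl⟩ := h.exists_lift x y (hfx.trans hgy.symm)
  obtain ⟨w, hw₁, hw₂⟩ := h.exists_lift (π₁ z) 0 (hfx.trans (map_zero g).symm)
  have hwR : IsWeaklyRegular R (us.map π₁ ++ [π₁ z]) := IsRegularLocalRing.isWeaklyRegular
    (by rw [ofList_append, ofList_singleton, ← hx, sup_comm, hmR]) (by simp [hR])
  have hwS : IsWeaklyRegular S (us.map π₂ ++ [π₂ z]) := IsRegularLocalRing.isWeaklyRegular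
    (by rw [ofList_append, ofList_singleton, ← hy, sup_comm, hmS]) (by simp [hS])
  have hreg : IsRegular A (us ++ [z]) := by
    refine h.isRegular_append_singleton hf hg hfx hts htlen ?_ ?_
    · rwa [List.map_append, List.map_singleton]
    · rwa [List.map_append, List.map_singleton]
  have husR : ofList (us.map π₁) ≤ maximalIdeal R := hmR ▸ le_sup_right
  have husS : ofList (us.map π₂) ≤ maximalIdeal S := hmS ▸ le_sup_right
  have husA : ofList us ≤ maximalIdeal A := fun u hu ↦
    (map_mem_maximalIdeal_iff hπ₁).1 (husR (map_ofList π₁ us ▸ Ideal.mem_map_of_mem π₁ hu))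
  have hzm : z ∈ maximalIdeal A := (map_mem_maximalIdeal_iff hπ₁).1 (hmR ▸ Ideal.mem_sup_left hfx)
  have hwm : w ∈ maximalIdeal A :=
    (map_mem_maximalIdeal_iff hπ₁).1 (hw₁ ▸ hmR ▸ Ideal.mem_sup_left hfx)
  refine ⟨_, hasInjectiveDimensionLE_of_length_two hreg (w := w) ?_
    (fun a ↦ h.mul_mem_ofList_append hg hw₁ hw₂ hmR.le) ?_⟩
  · rw [ofList_append, ofList_singleton]
    refine le_antisymm (fun a ha ↦ ?_) (sup_le (sup_le husA ?_) ?_)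
    · have ha₁ := (map_mem_maximalIdeal_iff hπ₁).2 ha
      rw [hmR] at ha₁
      obtain ⟨p, hp, r, hr, hpr⟩ := Submodule.mem_sup.1 ha₁
      rw [← map_ofList] at hr
      obtain ⟨ρ, hρ, rfl⟩ := (Ideal.mem_map_iff_of_surjective π₁ hπ₁).1 hr
      -- `a - ρ` lies in the kernel of `A → T`, which is `ker f × ker g`
      have hg0 : π₂ (a - ρ) ∈ RingHom.ker g := by
        rw [RingHom.mem_ker, ← h.comm, map_sub, ← hpr, add_sub_cancel_right]
        exact hp
      rw [hx] at hp
      rw [hy] at hg0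
      obtain ⟨b, rfl⟩ := Ideal.mem_span_singleton'.1 hp
      obtain ⟨c, hc⟩ := Ideal.mem_span_singleton'.1 hg0
      obtain ⟨b, rfl⟩ := hπ₁ b
      obtain ⟨c, rfl⟩ := hπ₂ c
      have ha : a = (ρ + c * z) + (b - c) * w := by
        refine h.eq_of_map_eq ?_ ?_
        · simp only [map_add, map_mul, map_sub, hw₁, ← hpr]
          ring
        · rw [map_sub] at hc
          simp only [map_add, map_mul, hw₂, hc]
          ring
      rw [ha]
      exact Submodule.add_mem_sup (Submodule.add_mem_sup hρ
        (Ideal.mul_mem_left _ _ (Ideal.mem_span_singleton_self z)))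
        (Ideal.mul_mem_left _ _ (Ideal.mem_span_singleton_self w))
    · exact (Ideal.span_singleton_le_iff_mem _).2 hzm
    · exact (Ideal.span_singleton_le_iff_mem _).2 hwm
  · intro hwq
    rw [ofList_append, ofList_singleton] at hwq
    obtain ⟨ρ, hρ, c', hc', hw⟩ := Submodule.mem_sup.1 hwq
    obtain ⟨c, rfl⟩ := Ideal.mem_span_singleton'.1 hc'
    have hρ₁ : π₁ ρ ∈ ofList (us.map π₁) := map_ofList π₁ us ▸ Ideal.mem_map_of_mem π₁ hρ
    have hρ₂ : π₂ ρ ∈ ofList (us.map π₂) := map_ofList π₂ us ▸ Ideal.mem_map_of_mem π₂ hρ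
    have h₂ : π₂ z * π₂ c = -π₂ ρ := by
      have h3 := congrArg π₂ hw
      rw [hw₂, map_add, map_mul] at h3
      linear_combination h3
    have h₁ : π₁ z * (1 - π₁ c) = π₁ ρ := by
      have h3 := congrArg π₁ hw
      rw [hw₁, map_add, map_mul] at h3
      linear_combination -h3
    have hc := (map_mem_maximalIdeal_iff hπ₂).1
      (husS (hwS.mem_of_mul_mem (h₂ ▸ neg_mem hρ₂)))
    have h4 := add_mem (husR (hwR.mem_of_mul_mem (h₁ ▸ hρ₁)))
      ((map_mem_maximalIdeal_iff hπ₁).2 hc)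
    rw [sub_add_cancel] at h4
    exact (mem_maximalIdeal _).1 h4 isUnit_one

end RingHom.IsFiberProduct

end Implications

theorem proposition4p17 {R S T : Type*} [CommRing R] [CommRing S] [CommRing T]
    [IsCohenMacaulayLocalRing R] [IsCohenMacaulayLocalRing S] [IsRegularLocalRing T]
    (d : ℕ) (hd : 0 < d)
    (hR : ringKrullDim R = (d : WithBot ℕ∞)) (hS : ringKrullDim S = (d : WithBot ℕ∞))
    (hT : ringKrullDim T = ((d - 1 : ℕ) : WithBot ℕ∞))
    (f : R →+* T) (g : S →+* T)
    (hf : Function.Surjective f) (hg : Function.Surjective g) :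
    IsGorensteinLocalRing (fiberProduct f g) ↔
      IsRegularLocalRing R ∧ IsRegularLocalRing S := by
  obtain ⟨n, rfl⟩ : ∃ n, d = n + 1 := ⟨d - 1, by omega⟩
  rw [Nat.add_sub_cancel] at hT
  have h := fiberProduct.isFiberProduct f g
  constructor
  · intro hA
    obtain ⟨k, hk⟩ := hA.finite_injectiveDimension
    exact h.isRegularLocalRing_of_hasInjectiveDimensionLE hf hg hR hS hT (k := k)
  · rintro ⟨_, _⟩
    exact h.isGorensteinLocalRing hf hg hR hS hT
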